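/- **Setting.** Let $G$ be a finite-dimensional real Lie group with Lie algebra $\mathfrak g$. Left trivialisation identifies $TG\cong G\times\mathfrak g$ and $T^*(TG)\cong G\times\mathfrak g\times\mathfrak g^*\times\mathfrak g^*\ni(g,\xi,\mu,\nu)$. The canonical one-form is $\theta(g,\xi,\mu,\nu)(\delta g,\delta\xi,\delta\mu,\delta\nu)=\langle\mu,g^{-1}\delta g\rangle+\langle\nu,\delta\xi\rangle$, and the canonical symplectic form is $\omega=-d\theta$. Let $\ell:\mathfrak g\times\mathfrak g\to\mathbb R$ be a smooth reduced Lagrangian, $h>0$ a step size, $(a_{ij})_{i,j=1}^s$, $(b_i)_{i=1}^s$ real Runge–Kutta coefficients, and $\tau$ a smooth diffeomorphism from an open neighbourhood $U$ of $0\in\mathfrak g$ onto an open subset of $G$ with $\tau(0)=e$, extended to a map $\mathfrak g\to G$ with $\tau(-\eta)\tau(\eta)=e$ for $\eta\in U$. Put $d\tau_\xi(\eta)=(T_\xi\tau(\eta))\,\tau(\xi)^{-1}\in\mathfrak g$. **Scheme.** For $N\ge1$ a discrete path $\gamma$ consists of $(g_0,\xi_0)\in G\times\mathfrak g$, nodes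 $(g_k,\xi_k,\check\mu_k,\nu_k)\in G\times\mathfrak g\times\mathfrak g^*\times\mathfrak g^*$ $(1\le k\le N)$ and internal stage variables $(G_k^i,\Xi_k^i,V_k^i,\mu_k^i,\nu_k^i)\in G\times\mathfrak g^2\times(\mathfrak g^*)^2$ $(0\le k\le N-1,\ 1\le i\le s)$, where all $g_k^{-1}g_{k+1}$ and $g_k^{-1}G_k^i$ lie in $\tau(U)$. Set $$\begin{aligned}S(\gamma)=h\sum_{k=0}^{N-1}\Big\{&\sum_{i=1}^s\Big[b_i\,\ell(\Xi_k^i,V_k^i)+\Big\langle\mu_k^i,\tfrac1h\tau^{-1}(g_k^{-1}G_k^i)-\sum_ja_{ij}\Xi_k^j\Big\rangle+\Big\langle\nu_k^i,\tfrac1h(\Xi_k^i-\xi_k)-\sum_ja_{ij}V_k^j\Big\rangle\Big]\\&+\Big\langle\check\mu_{k+1},\tfrac1h\tau^{-1}(g_k^{-1}g_{k+1})-\sum_ib_i\Xi_k^i\Big\rangle+\Big\langle\nu_{k+1},\tfrac1h(\xi_{k+1}-\xi_k)-\sum_ib_iV_k^i\Big\rangle\Big\}.\end{aligned}$$ A path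 $\gamma$ is a *solution* if $\delta S=0$ for all smooth variations of $\gamma$ with $g_0,g_N,\xi_0,\xi_N$ fixed. With $\Xi_{k+1}=\sum_jb_j\Xi_k^j$ and $\Theta_0^i=\sum_ja_{ij}\Xi_0^j$, set $$\mu_k=(d\tau^{-1}_{-h\Xi_k})^*\check\mu_k\ (1\le k\le N),\qquad \mu_0=(d\tau^{-1}_{h\Xi_1})^*\check\mu_1+\sum_i(d\tau^{-1}_{h\Theta_0^i})^*\mu_0^i,\qquad \nu_0=\nu_1+\sum_i\nu_0^i.$$ The *initial conditions* of $\gamma$ are $(g_0,\xi_0,\mu_0,\nu_0)\in T^*(TG)$. **Assumption (elimination of internal variables).** Let $D\subseteq T^*(TG)$ be open (for instance $D=T^*(TG)$). Suppose there are smooth functions on $D$, one giving stage variables $w(z)$ and one giving $F(z)\in T^*(TG)$, such that for each $z\in D$ there is a one-step solution ($N=1$) with initial conditions $z$, stage variables $w(z)$ and end node $(g_1,\xi_1,\mu_1,\nu_1)=F(z)$. The map $F$ is the discrete flow map. **Claim.** Let $N\ge1$ and let $z\in T^*(TG)$ with $F^k(z)\in D$ for $0\le k<N$. Let $\gamma_z$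 be the $N$-step path with stage variables $w(F^k(z))$ in step $k$, $0\le k<N$, and with $(g_k,\xi_k,\mu_k,\nu_k)=F^k(z)$, $0\le k\le N$. Then $\gamma_z$ is a solution with initial conditions $z$. The function $s(z)=S(\gamma_z)$ is differentiable on the (open) set of such $z$, and on this set $$ds=(F^N)^*\theta-\theta,\qquad (F^N)^*\omega=\omega .$$ In particular $F^*\omega=\omega$ on $D$; that is, the discrete flow map preserves the canonical symplectic form. -/

import Mathlib

open scoped Manifold ContDiff

noncomputable section

/-!
Throughout, `G` is a real Lie group modelled on the finite-dimensional space `E`. The Lie algebra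
`T_1 G` of `G` is, in Mathlib, definitionally the space `E`; it is written `E` below because `E`
carries a norm. Its dual is `E →L[ℝ] ℝ`.
-/

namespace HOHP

section Spaces

variable (E : Type*) [NormedAddCommGroup E] [NormedSpace ℝ E]
  (G : Type*) [TopologicalSpace G] [ChartedSpace E G] [Group G]

theorem groupLieAlgebra_eq : GroupLieAlgebra 𝓘(ℝ, E) G = E := rfl

/-- The dual of the Lie algebra. -/
abbrev Dual := E →L[ℝ] ℝ

/-- `TG ≅ G × 𝔤` by left trivialisation; elements are pairs `(g, ξ)`. -/
abbrev TG := G × E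

/-- `T*(TG) ≅ G × 𝔤 × 𝔤* × 𝔤*` by left trivialisation; elements are `(g, ξ, μ, ν)`. -/
abbrev CotTG := G × E × Dual E × Dual E

/-- The model with corners of `TG`. -/
abbrev modelTG := (𝓘(ℝ, E)).prod 𝓘(ℝ, E)

/-- The model with corners of `T*(TG)`. -/
abbrev modelCot := (𝓘(ℝ, E)).prod 𝓘(ℝ, E × Dual E × Dual E)

/-- The vector space on which `T*(TG)` is modelled. -/
abbrev ModelCotSpace := E × E × Dual E × Dual E

end Spaces

section Forms

variable {E : Type*} [NormedAddCommGroup E] [NormedSpace ℝ E]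
  {G : Type*} [TopologicalSpace G] [ChartedSpace E G] [Group G]

namespace CotTG

/-- The base point in `G`. -/
abbrev g (z : CotTG E G) : G := z.1

/-- The left-trivialised velocity. -/
abbrev ξ (z : CotTG E G) : E := z.2.1

/-- The momentum conjugate to the group variable. -/
abbrev μ (z : CotTG E G) : Dual E := z.2.2.1

/-- The momentum conjugate to the velocity. -/
abbrev ν (z : CotTG E G) : Dual E := z.2.2.2

/-- The projection `T*(TG) → TG`. -/
def proj (z : CotTG E G) : TG E G := (z.g, z.ξ)

end CotTG

/-- Left trivialisation `T_g G → 𝔤`, `δg ↦ g⁻¹ δg = T L_{g⁻¹} δg`. -/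
def leftTriv (g : G) : TangentSpace 𝓘(ℝ, E) g →L[ℝ] E :=
  mfderiv 𝓘(ℝ, E) 𝓘(ℝ, E) (fun x : G => g⁻¹ * x) g

/-- The covector on `TG` at `(g, ξ)` that `z = (g, ξ, μ, ν)` stands for:
`(δg, δξ) ↦ ⟨μ, g⁻¹ δg⟩ + ⟨ν, δξ⟩`. -/
def covector (z : CotTG E G) : TangentSpace (modelTG E) z.proj →L[ℝ] ℝ :=
  (z.μ.comp (leftTriv z.g)).comp (ContinuousLinearMap.fst ℝ E E) +
    z.ν.comp (ContinuousLinearMap.snd ℝ E E)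

/-- The canonical (tautological) one-form on `T*(TG)`:
`θ(z)(v) = z (T proj v)`, that is, `⟨μ, g⁻¹ δg⟩ + ⟨ν, δξ⟩`. -/
def canonicalOneForm (z : CotTG E G) : TangentSpace (modelCot E) z →L[ℝ] ℝ :=
  (covector z).comp (mfderiv (modelCot E) (modelTG E) (CotTG.proj : CotTG E G → TG E G) z)

/-- The pullback of a one-form on `T*(TG)` by a map. -/
def pullbackOneForm (Φ : CotTG E G → CotTG E G)
    (α : ∀ z : CotTG E G, TangentSpace (modelCot E) z →L[ℝ] ℝ) (z : CotTG E G) :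
    TangentSpace (modelCot E) z →L[ℝ] ℝ :=
  (α (Φ z)).comp (mfderiv (modelCot E) (modelCot E) Φ z)

/-- The pullback of a two-form on `T*(TG)` by a map. -/
def pullbackTwoForm (Φ : CotTG E G → CotTG E G)
    (α : ∀ z : CotTG E G, TangentSpace (modelCot E) z [⋀^Fin 2]→L[ℝ] ℝ) (z : CotTG E G) :
    TangentSpace (modelCot E) z [⋀^Fin 2]→L[ℝ] ℝ :=
  (α (Φ z)).compContinuousLinearMap (mfderiv (modelCot E) (modelCot E) Φ z)

/-- A one-form on `T*(TG)` read in the preferred chart at `y`, as a one-form on the model space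
(meaningful on the target of the chart). -/
def chartOneForm (α : ∀ z : CotTG E G, TangentSpace (modelCot E) z →L[ℝ] ℝ) (y : CotTG E G)
    (x : ModelCotSpace E) : ModelCotSpace E [⋀^Fin 1]→L[ℝ] ℝ :=
  ContinuousAlternatingMap.ofSubsingleton ℝ (ModelCotSpace E) ℝ (0 : Fin 1)
    ((α ((extChartAt (modelCot E) y).symm x)).comp
      (mfderiv 𝓘(ℝ, ModelCotSpace E) (modelCot E) (extChartAt (modelCot E) y).symm x))

/-- The exterior derivative of a one-form on `T*(TG)`, computed at `y` in the preferred chart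
at `y`. -/
def exteriorDerivative (α : ∀ z : CotTG E G, TangentSpace (modelCot E) z →L[ℝ] ℝ)
    (y : CotTG E G) : TangentSpace (modelCot E) y [⋀^Fin 2]→L[ℝ] ℝ :=
  (extDeriv (chartOneForm α y) (extChartAt (modelCot E) y y)).compContinuousLinearMap
    (mfderiv (modelCot E) 𝓘(ℝ, ModelCotSpace E) (extChartAt (modelCot E) y) y)

/-- The canonical symplectic form on `T*(TG)`, with the sign convention `ω = -dθ`. -/
def canonicalSymplecticForm (z : CotTG E G) : TangentSpace (modelCot E) z [⋀^Fin 2]→L[ℝ] ℝ :=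
  -exteriorDerivative canonicalOneForm z

end Forms

section Scheme

/-- The data of a discrete higher-order Hamilton-Pontryagin scheme with `s` stages. -/
structure Scheme (E : Type*) [NormedAddCommGroup E] [NormedSpace ℝ E]
    (G : Type*) [TopologicalSpace G] [ChartedSpace E G] [Group G] (s : ℕ) where
  /-- Runge-Kutta matrix. -/
  a : Fin s → Fin s → ℝ
  /-- Runge-Kutta weights. -/
  b : Fin s → ℝ
  /-- Time step. -/
  h : ℝ
  h_pos : 0 < h
  /-- Reduced second-order Lagrangian `ℓ(ξ, u)`. -/
  ℓ : E × E → ℝ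
  ℓ_smooth : ContDiff ℝ ∞ ℓ
  /-- The local diffeomorphism `τ` from a neighbourhood of `0` in the Lie algebra (its source)
  onto a neighbourhood of `1` in `G` (its target). -/
  τ : OpenPartialHomeomorph E G
  zero_mem : (0 : E) ∈ τ.source
  τ_zero : τ 0 = 1
  τ_smooth : ContMDiffOn 𝓘(ℝ, E) 𝓘(ℝ, E) ∞ τ τ.source
  τ_symm_smooth : ContMDiffOn 𝓘(ℝ, E) 𝓘(ℝ, E) ∞ τ.symm τ.target
  τ_neg : ∀ η ∈ τ.source, τ (-η) * τ η = 1

/-- The internal stage variables `(Gⁱ, Ξⁱ, Vⁱ, μⁱ, νⁱ)`, `i = 1, …, s`, of one time step: an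
element of the `s`-th power of the (left-trivialised) Pontryagin bundle. -/
structure Stages (E : Type*) [NormedAddCommGroup E] [NormedSpace ℝ E] (G : Type*) (s : ℕ) where
  Gs : Fin s → G
  Ξ : Fin s → E
  V : Fin s → E
  μ : Fin s → Dual E
  ν : Fin s → Dual E

/-- The discrete path space with `N` steps, `TG × T*(TG)^N × (P⁽²⁾G)^{N s}`. -/
structure Path (E : Type*) [NormedAddCommGroup E] [NormedSpace ℝ E] (G : Type*) (s N : ℕ) where
  /-- `g k = g_k` for `k = 0, …, N`. -/
  g : Fin (N + 1) → G
  /-- `ξ k = ξ_k` for `k = 0, …, N`. -/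
  ξ : Fin (N + 1) → E
  /-- `μc k` is the multiplier `μ̌_{k+1}`, for `k = 0, …, N - 1`. -/
  μc : Fin N → Dual E
  /-- `ν k` is the multiplier `ν_{k+1}`, for `k = 0, …, N - 1`. -/
  ν : Fin N → Dual E
  /-- `stage k` holds the stage variables of the step from `k` to `k + 1`. -/
  stage : Fin N → Stages E G s

variable {E : Type*} [NormedAddCommGroup E] [NormedSpace ℝ E]
  {G : Type*} [TopologicalSpace G] [ChartedSpace E G] [Group G] {s N : ℕ}

namespace Scheme

/-- The right-trivialised differential `dτ_ξ : 𝔤 → 𝔤`, `η ↦ (T_ξ τ η) τ(ξ)⁻¹`. -/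
def dτ (P : Scheme E G s) (ξ : E) : E →L[ℝ] E :=
  mfderiv 𝓘(ℝ, E) 𝓘(ℝ, E) (fun η : E => P.τ η * (P.τ ξ)⁻¹) ξ

/-- The inverse `dτ_ξ⁻¹ : 𝔤 → 𝔤`. -/
def dτInv (P : Scheme E G s) (ξ : E) : E →L[ℝ] E := (P.dτ ξ).inverse

/-- `Σ_j b_j Ξ^j`, written `Ξ_{k+1}` for the stages of step `k`. -/
def average (P : Scheme E G s) (w : Stages E G s) : E := ∑ j, P.b j • w.Ξ j

/-- `Θ^i = Σ_j a_{ij} Ξ^j`. -/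
def theta (P : Scheme E G s) (w : Stages E G s) (i : Fin s) : E := ∑ j, P.a i j • w.Ξ j

/-- The discrete Hamilton-Pontryagin functional. -/
def action (P : Scheme E G s) (γ : Path E G s N) : ℝ :=
  P.h * ∑ k : Fin N,
    ((∑ i : Fin s,
        (P.b i * P.ℓ ((γ.stage k).Ξ i, (γ.stage k).V i)
          + (γ.stage k).μ i
              ((1 / P.h) • P.τ.symm ((γ.g k.castSucc)⁻¹ * (γ.stage k).Gs i)
                - ∑ j, P.a i j • (γ.stage k).Ξ j)
          + (γ.stage k).ν i
              ((1 / P.h) • ((γ.stage k).Ξ i - γ.ξ k.castSucc)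
                - ∑ j, P.a i j • (γ.stage k).V j)))
      + γ.μc k
          ((1 / P.h) • P.τ.symm ((γ.g k.castSucc)⁻¹ * γ.g k.succ)
            - ∑ i, P.b i • (γ.stage k).Ξ i)
      + γ.ν k
          ((1 / P.h) • (γ.ξ k.succ - γ.ξ k.castSucc)
            - ∑ i, P.b i • (γ.stage k).V i))

/-- The open set of discrete paths on which the functional is defined: all arguments of `τ⁻¹`
lie in its domain. -/
def Admissible (P : Scheme E G s) (γ : Path E G s N) : Prop :=
  ∀ k : Fin N, (γ.g k.castSucc)⁻¹ * γ.g k.succ ∈ P.τ.target ∧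
    ∀ i : Fin s, (γ.g k.castSucc)⁻¹ * (γ.stage k).Gs i ∈ P.τ.target

end Scheme

/-- `c` is a variation of the discrete path `γ` with fixed boundary points and velocities: a curve
of discrete paths through `γ`, smooth near `ε = 0`, with constant `g_0, g_N, ξ_0, ξ_N`. -/
structure IsVariation (γ : Path E G s N) (c : ℝ → Path E G s N) : Prop where
  at_zero : c 0 = γ
  g_zero : ∀ ε, (c ε).g 0 = γ.g 0
  g_last : ∀ ε, (c ε).g (Fin.last N) = γ.g (Fin.last N)
  ξ_zero : ∀ ε, (c ε).ξ 0 = γ.ξ 0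
  ξ_last : ∀ ε, (c ε).ξ (Fin.last N) = γ.ξ (Fin.last N)
  g_smooth : ∀ k, ContMDiffAt 𝓘(ℝ, ℝ) 𝓘(ℝ, E) ∞ (fun ε => (c ε).g k) 0
  ξ_smooth : ∀ k, ContDiffAt ℝ ∞ (fun ε => (c ε).ξ k) 0
  μc_smooth : ∀ k, ContDiffAt ℝ ∞ (fun ε => (c ε).μc k) 0
  ν_smooth : ∀ k, ContDiffAt ℝ ∞ (fun ε => (c ε).ν k) 0
  stageG_smooth : ∀ k i, ContMDiffAt 𝓘(ℝ, ℝ) 𝓘(ℝ, E) ∞ (fun ε => ((c ε).stage k).Gs i) 0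
  stageΞ_smooth : ∀ k i, ContDiffAt ℝ ∞ (fun ε => ((c ε).stage k).Ξ i) 0
  stageV_smooth : ∀ k i, ContDiffAt ℝ ∞ (fun ε => ((c ε).stage k).V i) 0
  stageμ_smooth : ∀ k i, ContDiffAt ℝ ∞ (fun ε => ((c ε).stage k).μ i) 0
  stageν_smooth : ∀ k i, ContDiffAt ℝ ∞ (fun ε => ((c ε).stage k).ν i) 0

namespace Scheme

/-- Solutions of the discrete Hamilton-Pontryagin principle: critical points of the functional
for variations with fixed boundary points and velocities. -/
def IsSolution (P : Scheme E G s) (γ : Path E G s N) : Prop :=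
  P.Admissible γ ∧
    ∀ c : ℝ → Path E G s N, IsVariation γ c → HasDerivAt (fun ε => P.action (c ε)) 0 0

/-- The initial conditions `(g_0, ξ_0, μ_0, ν_0)` of a discrete path, where
`ν_0 = ν_1 + Σ_i ν_0^i` and
`μ_0 = (dτ⁻¹_{hΞ_1})* μ̌_1 + Σ_i (dτ⁻¹_{hΘ_0^i})* μ_0^i`. -/
def initial [NeZero N] (P : Scheme E G s) (γ : Path E G s N) : CotTG E G :=
  (γ.g 0, γ.ξ 0,
    (γ.μc 0).comp (P.dτInv (P.h • P.average (γ.stage 0)))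
      + ∑ i, ((γ.stage 0).μ i).comp (P.dτInv (P.h • P.theta (γ.stage 0) i)),
    γ.ν 0 + ∑ i, (γ.stage 0).ν i)

/-- The node `(g_{k+1}, ξ_{k+1}, μ_{k+1}, ν_{k+1})` of a discrete path, `k = 0, …, N - 1`, where
`μ_{k+1} = (dτ⁻¹_{-hΞ_{k+1}})* μ̌_{k+1}`. -/
def node (P : Scheme E G s) (γ : Path E G s N) (k : Fin N) : CotTG E G :=
  (γ.g k.succ, γ.ξ k.succ,
    (γ.μc k).comp (P.dτInv (-(P.h • P.average (γ.stage k)))),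
    γ.ν k)

/-- The discrete path with nodes `F^k(z)`, stage variables `w(F^k(z))` and
`μ̌_{k+1} = (dτ_{-hΞ_{k+1}})* μ_{k+1}`. -/
def trajectory (P : Scheme E G s) (F : CotTG E G → CotTG E G) (w : CotTG E G → Stages E G s)
    (N : ℕ) (z : CotTG E G) : Path E G s N where
  g k := CotTG.g (F^[(k : ℕ)] z)
  ξ k := CotTG.ξ (F^[(k : ℕ)] z)
  μc k := (CotTG.μ (F^[(k : ℕ) + 1] z)).comp
    (P.dτ (-(P.h • P.average (w (F^[(k : ℕ)] z)))))
  ν k := CotTG.ν (F^[(k : ℕ) + 1] z)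
  stage k := w (F^[(k : ℕ)] z)

/-- On the open set `D` of `T*(TG)` the stage variables of one step can be eliminated: they are
smooth functions `w` of the initial conditions `z`, and the scheme then induces the smooth discrete
flow map `F`. That is, for `z ∈ D` the one-step path with stage variables `w z` and end node `F z`
is a solution of the discrete principle with initial conditions `z`. -/
structure IsDiscreteFlow (P : Scheme E G s) (D : Set (CotTG E G))
    (F : CotTG E G → CotTG E G) (w : CotTG E G → Stages E G s) : Prop where
  isOpen : IsOpen D
  F_smooth : ContMDiffOn (modelCot E) (modelCot E) ∞ F D
  G_smooth : ∀ i, ContMDiffOn (modelCot E) 𝓘(ℝ, E) ∞ (fun z => (w z).Gs i) D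
  Ξ_smooth : ∀ i, ContMDiffOn (modelCot E) 𝓘(ℝ, E) ∞ (fun z => (w z).Ξ i) D
  V_smooth : ∀ i, ContMDiffOn (modelCot E) 𝓘(ℝ, E) ∞ (fun z => (w z).V i) D
  μ_smooth : ∀ i, ContMDiffOn (modelCot E) 𝓘(ℝ, Dual E) ∞ (fun z => (w z).μ i) D
  ν_smooth : ∀ i, ContMDiffOn (modelCot E) 𝓘(ℝ, Dual E) ∞ (fun z => (w z).ν i) D
  solution : ∀ z ∈ D, P.IsSolution (P.trajectory F w 1 z)
  initial_eq : ∀ z ∈ D, P.initial (P.trajectory F w 1 z) = z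
  node_eq : ∀ z ∈ D, P.node (P.trajectory F w 1 z) 0 = F z

end Scheme

end Scheme

end HOHP

end

noncomputable section

/-! The action is a sum over steps. With each `Gⁱ` replaced by `yⁱ = τ⁻¹(g_k⁻¹ Gⁱ)`, a summand sees
the nodes only through `τ⁻¹(g_k⁻¹ g_{k+1})`, `ξ_k`, `ξ_{k+1}`, and a one-step solution is stationary
in all remaining directions. Stationarity in `μ̌` gives `τ⁻¹(g_k⁻¹ g_{k+1}) = hΞ_{k+1}`, and
stationarity in `yⁱ` gives `μⁱ = 0`. Hence, along any differentiable family of paths through such a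
path, the derivative of the summand consists of boundary terms. The formula for `δτ⁻¹(a⁻¹b)`
(`modelDeriv_τ_symm_inv_mul`) turns them into `⟨μ, g⁻¹δg⟩ + ⟨ν, δξ⟩` at the end of the step minus
the same expression at its start (`hasMFDerivAt_stepAction_family`). If the final momenta of each
step are the initial momenta of the next, the sum telescopes (`hasMFDerivAt_action_family`).

This is applied to two families. Variations with fixed ends give derivative zero, so concatenated
one-step solutions are solutions. The family `z ↦ γ_z` gives `ds = (F^N)^*θ - θ`. Since `d` commutes
with pullback and `d² = 0`, the second identity yields `(F^N)^*dθ = dθ`.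

The analytic input is that derivatives such as `dτ_ξ` and left trivialisation depend smoothly on the
base point (`contDiffAt_modelDeriv_diag`). -/

namespace HOHP

open Filter Topology

/-! ### Calculus of manifold derivatives between fixed model spaces -/

section ManifoldDeriv

variable {V : Type*} [NormedAddCommGroup V] [NormedSpace ℝ V] {H : Type*} [TopologicalSpace H]
  {I : ModelWithCorners ℝ V H} {M : Type*} [TopologicalSpace M] [ChartedSpace H M]
  {V' : Type*} [NormedAddCommGroup V'] [NormedSpace ℝ V'] {H' : Type*} [TopologicalSpace H']
  {I' : ModelWithCorners ℝ V' H'} {M' : Type*} [TopologicalSpace M'] [ChartedSpace H' M']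
  {V'' : Type*} [NormedAddCommGroup V''] [NormedSpace ℝ V''] {H'' : Type*} [TopologicalSpace H'']
  {I'' : ModelWithCorners ℝ V'' H''} {M'' : Type*} [TopologicalSpace M''] [ChartedSpace H'' M'']

variable (I I') in
/-- The manifold derivative as a map between the model spaces, with which each tangent space
coincides definitionally; its type does not depend on the point. -/
def modelDeriv (f : M → M') (x : M) : V →L[ℝ] V' := mfderiv I I' f x

/-- The intermediate point is a separate variable tied by an equation, so the outer derivative can
be taken at a simplified point such as `1`. -/
theorem modelDeriv_comp {f : M → M'} {g : M' → M''} {x : M} {y : M'} (h : f x = y)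
    (hg : MDifferentiableAt I' I'' g y) (hf : MDifferentiableAt I I' f x) :
    modelDeriv I I'' (fun t => g (f t)) x = (modelDeriv I' I'' g y).comp (modelDeriv I I' f x) := by
  subst h
  exact mfderiv_comp x hg hf

theorem modelDeriv_congr {f g : M → M'} {x : M} (h : f =ᶠ[𝓝 x] g) :
    modelDeriv I I' f x = modelDeriv I I' g x :=
  h.mfderiv_eq

theorem modelDeriv_id (x : M) : modelDeriv I I (fun t => t) x = ContinuousLinearMap.id ℝ V :=
  mfderiv_id

theorem modelDeriv_const (c : M') (x : M) : modelDeriv I I' (fun _ => c) x = 0 :=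
  mfderiv_const

theorem modelDeriv_eq_fderiv (f : V → V') (x : V) :
    modelDeriv 𝓘(ℝ, V) 𝓘(ℝ, V') f x = fderiv ℝ f x :=
  mfderiv_eq_fderiv

theorem modelDeriv_prodMk {f : M → M'} {g : M → M''} {x : M} (hf : MDifferentiableAt I I' f x)
    (hg : MDifferentiableAt I I'' g x) :
    modelDeriv I (I'.prod I'') (fun t => (f t, g t)) x
      = (modelDeriv I I' f x).prod (modelDeriv I I'' g x) :=
  mfderiv_prodMk hf hg

theorem modelDeriv_prodMk_space {f : M → V'} {g : M → V''} {x : M}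
    (hf : MDifferentiableAt I 𝓘(ℝ, V') f x) (hg : MDifferentiableAt I 𝓘(ℝ, V'') g x) :
    modelDeriv I 𝓘(ℝ, V' × V'') (fun t => (f t, g t)) x
      = (modelDeriv I 𝓘(ℝ, V') f x).prod (modelDeriv I 𝓘(ℝ, V'') g x) := by
  have h : HasMFDerivAt I 𝓘(ℝ, V' × V'') (fun t => (f t, g t)) x
      ((modelDeriv I 𝓘(ℝ, V') f x).prod (modelDeriv I 𝓘(ℝ, V'') g x) : V →L[ℝ] V' × V'') :=
    ⟨hf.hasMFDerivAt.1.prodMk hg.hasMFDerivAt.1, hf.hasMFDerivAt.2.prodMk hg.hasMFDerivAt.2⟩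
  exact h.mfderiv

/-- The total derivative on a product is the sum of its partial derivatives. -/
theorem modelDeriv_comp₂ {N : Type*} [TopologicalSpace N] {W K : Type*} [NormedAddCommGroup W]
    [NormedSpace ℝ W] [TopologicalSpace K] {J : ModelWithCorners ℝ W K} [ChartedSpace K N]
    {f : M × M' → M''} {a : N → M} {b : N → M'} {p : N} {x : M} {y : M'}
    (ha' : a p = x) (hb' : b p = y)
    (hf : MDifferentiableAt (I.prod I') I'' f (x, y))
    (ha : MDifferentiableAt J I a p) (hb : MDifferentiableAt J I' b p) :
    modelDeriv J I'' (fun t => f (a t, b t)) p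
      = (modelDeriv I I'' (fun t => f (t, y)) x).comp (modelDeriv J I a p)
        + (modelDeriv I' I'' (fun t => f (x, t)) y).comp (modelDeriv J I' b p) := by
  subst ha' hb'
  rw [modelDeriv_comp (f := fun t => (a t, b t)) (g := f) rfl hf (ha.prodMk hb),
    modelDeriv_prodMk ha hb]
  ext v
  exact mfderiv_prod_eq_add_apply hf

theorem hasMFDerivAt_modelDeriv {f : M → M'} {x : M} (hf : MDifferentiableAt I I' f x) :
    HasMFDerivAt I I' f x (modelDeriv I I' f x : V →L[ℝ] V') :=
  hf.hasMFDerivAt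

theorem modelDeriv_eq {f : M → M'} {x : M} {f' : V →L[ℝ] V'} (h : HasMFDerivAt I I' f x f') :
    modelDeriv I I' f x = f' :=
  h.mfderiv

end ManifoldDeriv

/-! ### Inversion and left trivialisation on the group -/

section Group

variable {E : Type*} [NormedAddCommGroup E] [NormedSpace ℝ E]
  {G : Type*} [TopologicalSpace G] [ChartedSpace E G] [Group G] [LieGroup 𝓘(ℝ, E) ∞ G]
  {V : Type*} [NormedAddCommGroup V] [NormedSpace ℝ V] {H : Type*} [TopologicalSpace H]
  {I : ModelWithCorners ℝ V H} {M : Type*} [TopologicalSpace M] [ChartedSpace H M]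

theorem mdifferentiableAt_mul {f g : M → G} {x : M} (hf : MDifferentiableAt I 𝓘(ℝ, E) f x)
    (hg : MDifferentiableAt I 𝓘(ℝ, E) g x) :
    MDifferentiableAt I 𝓘(ℝ, E) (fun t => f t * g t) x :=
  ((contMDiff_mul 𝓘(ℝ, E) ∞ (G := G)).mdifferentiable (by simp) (f x, g x)).comp x (hf.prodMk hg)

theorem mdifferentiableAt_inv {f : M → G} {x : M} (hf : MDifferentiableAt I 𝓘(ℝ, E) f x) :
    MDifferentiableAt I 𝓘(ℝ, E) (fun t => (f t)⁻¹) x :=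
  ((contMDiff_inv 𝓘(ℝ, E) ∞ (G := G)).mdifferentiable (by simp) (f x)).comp x hf

/-- Differentiate `t * t⁻¹ = 1` at `1`: both partial derivatives of the product there are the
identity. -/
theorem modelDeriv_inv_one :
    modelDeriv 𝓘(ℝ, E) 𝓘(ℝ, E) (fun x : G => x⁻¹) 1 = -ContinuousLinearMap.id ℝ E := by
  have hi : MDifferentiableAt 𝓘(ℝ, E) 𝓘(ℝ, E) (fun x : G => x⁻¹) 1 :=
    mdifferentiableAt_inv mdifferentiableAt_id
  have h := modelDeriv_comp₂ (J := 𝓘(ℝ, E)) (f := fun q : G × G => q.1 * q.2) (a := fun t => t)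
    (b := fun t => t⁻¹) (p := 1) (x := 1) (y := 1) rfl inv_one
    ((contMDiff_mul 𝓘(ℝ, E) ∞ (G := G)).mdifferentiable (by simp) _) mdifferentiableAt_id hi
  simp only [mul_inv_cancel, mul_one, one_mul, modelDeriv_id, modelDeriv_const] at h
  rw [eq_neg_iff_add_eq_zero, add_comm]
  exact h.symm

theorem modelDeriv_inv_of_eq_one {f : M → G} {x : M} (hf : MDifferentiableAt I 𝓘(ℝ, E) f x)
    (h : f x = 1) :
    modelDeriv I 𝓘(ℝ, E) (fun t => (f t)⁻¹) x = -modelDeriv I 𝓘(ℝ, E) f x := by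
  rw [modelDeriv_comp (g := fun x : G => x⁻¹) h (mdifferentiableAt_inv mdifferentiableAt_id) hf,
    modelDeriv_inv_one]
  ext v
  simp

/-- Left trivialisation, as a map whose type does not depend on the point. -/
def leftTrivModel (g : G) : E →L[ℝ] E := leftTriv g

omit [LieGroup 𝓘(ℝ, E) ∞ G] in
theorem leftTrivModel_eq (g : G) :
    leftTrivModel g = modelDeriv 𝓘(ℝ, E) 𝓘(ℝ, E) (fun x : G => g⁻¹ * x) g := rfl

end Group

/-- In finite dimension a left inverse is two-sided. This is needed because `inverse` is zero by
default on maps that are not invertible. -/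
theorem inverse_comp_of_comp_eq_id {E : Type*} [NormedAddCommGroup E] [NormedSpace ℝ E]
    [FiniteDimensional ℝ E] {A B : E →L[ℝ] E} (h : B.comp A = ContinuousLinearMap.id ℝ E) :
    A.inverse.comp A = ContinuousLinearMap.id ℝ E := by
  have h' : A.comp B = ContinuousLinearMap.id ℝ E := by
    have := (LinearMap.comp_eq_id_comm ℝ E (f := (B : E →ₗ[ℝ] E)) (g := (A : E →ₗ[ℝ] E))).1
      (by ext v; exact DFunLike.congr_fun h v)
    ext v
    exact DFunLike.congr_fun this v
  rw [ContinuousLinearMap.inverse_eq h' h, h]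

/-! ### The trivialised differential of `τ` and the derivative of `τ⁻¹(a⁻¹b)` -/

namespace Scheme

variable {E : Type*} [NormedAddCommGroup E] [NormedSpace ℝ E]
  {G : Type*} [TopologicalSpace G] [ChartedSpace E G] [Group G]
  {s : ℕ} (P : Scheme E G s)

theorem contMDiffAt_τ {x : E} (hx : x ∈ P.τ.source) : ContMDiffAt 𝓘(ℝ, E) 𝓘(ℝ, E) ∞ P.τ x :=
  P.τ_smooth.contMDiffAt (P.τ.open_source.mem_nhds hx)

theorem mdifferentiableAt_τ {x : E} (hx : x ∈ P.τ.source) :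
    MDifferentiableAt 𝓘(ℝ, E) 𝓘(ℝ, E) P.τ x :=
  (P.contMDiffAt_τ hx).mdifferentiableAt (by simp)

theorem mdifferentiableAt_τ_symm {g : G} (hg : g ∈ P.τ.target) :
    MDifferentiableAt 𝓘(ℝ, E) 𝓘(ℝ, E) P.τ.symm g :=
  (P.τ_symm_smooth.contMDiffAt (P.τ.open_target.mem_nhds hg)).mdifferentiableAt (by simp)

theorem τ_neg_eq_inv {x : E} (hx : x ∈ P.τ.source) : P.τ (-x) = (P.τ x)⁻¹ :=
  eq_inv_of_mul_eq_one_left (P.τ_neg x hx)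

theorem dτ_eq_modelDeriv (x : E) :
    P.dτ x = modelDeriv 𝓘(ℝ, E) 𝓘(ℝ, E) (fun η => P.τ η * (P.τ x)⁻¹) x := rfl

variable [LieGroup 𝓘(ℝ, E) ∞ G]

/-- The point `-x` need not lie in the source of `τ`, but near it `τ` agrees with `η ↦ τ(-η)⁻¹`,
which is smooth. -/
theorem contMDiffAt_τ_neg {x : E} (hx : x ∈ P.τ.source) :
    ContMDiffAt 𝓘(ℝ, E) 𝓘(ℝ, E) ∞ P.τ (-x) := by
  have h : ContMDiffAt 𝓘(ℝ, E) 𝓘(ℝ, E) ∞ (fun η => (P.τ (-η))⁻¹) (-x) :=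
    ContMDiffAt.inv (ContMDiffAt.comp (-x) (by rw [neg_neg]; exact P.contMDiffAt_τ hx)
      (contDiff_neg.contMDiff.contMDiffAt))
  refine h.congr_of_eventuallyEq ?_
  filter_upwards [(P.τ.open_source.preimage continuous_neg).mem_nhds (x := -x) (by simpa using hx)]
    with η hη
  rw [← P.τ_neg_eq_inv hη, neg_neg]

theorem mdifferentiableAt_τ_neg {x : E} (hx : x ∈ P.τ.source) :
    MDifferentiableAt 𝓘(ℝ, E) 𝓘(ℝ, E) P.τ (-x) :=
  (P.contMDiffAt_τ_neg hx).mdifferentiableAt (by simp)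

variable [FiniteDimensional ℝ E]

theorem dτInv_comp_dτ {x : E} (hx : x ∈ P.τ.source) :
    (P.dτInv x).comp (P.dτ x) = ContinuousLinearMap.id ℝ E := by
  refine inverse_comp_of_comp_eq_id
    -- The inverse of `η ↦ τ(η)τ(x)⁻¹` is `g ↦ τ⁻¹(g τ(x))`. Its base point `1` is left unreduced so
    -- that it is literally the value of the inner map.
    (B := modelDeriv 𝓘(ℝ, E) 𝓘(ℝ, E) (fun g => P.τ.symm (g * P.τ x)) (P.τ x * (P.τ x)⁻¹)) ?_
  have hmul : MDifferentiableAt 𝓘(ℝ, E) 𝓘(ℝ, E) (fun g => g * P.τ x) (P.τ x * (P.τ x)⁻¹) :=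
    mdifferentiableAt_mul mdifferentiableAt_id mdifferentiableAt_const
  rw [dτ_eq_modelDeriv, ← modelDeriv_comp (f := fun η => P.τ η * (P.τ x)⁻¹)
    (g := fun g => P.τ.symm (g * P.τ x)) rfl, ← modelDeriv_id (I := 𝓘(ℝ, E)) x]
  · apply modelDeriv_congr
    filter_upwards [P.τ.open_source.mem_nhds hx] with η hη
    simp [P.τ.left_inv hη]
  · refine MDifferentiableAt.comp (I' := 𝓘(ℝ, E)) _ (P.mdifferentiableAt_τ_symm ?_) hmul
    simpa using P.τ.map_source hx
  · exact mdifferentiableAt_mul (P.mdifferentiableAt_τ hx) mdifferentiableAt_const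

/-- As `-x` may lie outside the source, the local inverse of `τ` near `τ(-x)` is taken to be `g ↦
-τ⁻¹(g⁻¹)`. -/
theorem dτInv_neg_comp_dτ {x : E} (hx : x ∈ P.τ.source) :
    (P.dτInv (-x)).comp (P.dτ (-x)) = ContinuousLinearMap.id ℝ E := by
  refine inverse_comp_of_comp_eq_id
    (B := modelDeriv 𝓘(ℝ, E) 𝓘(ℝ, E) (fun g => -P.τ.symm (g * P.τ (-x))⁻¹)
      (P.τ (-x) * (P.τ (-x))⁻¹)) ?_
  have hmul : MDifferentiableAt 𝓘(ℝ, E) 𝓘(ℝ, E) (fun g => (g * P.τ (-x))⁻¹)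
      (P.τ (-x) * (P.τ (-x))⁻¹) :=
    mdifferentiableAt_inv (mdifferentiableAt_mul mdifferentiableAt_id mdifferentiableAt_const)
  rw [dτ_eq_modelDeriv, ← modelDeriv_comp (f := fun η => P.τ η * (P.τ (-x))⁻¹)
    (g := fun g => -P.τ.symm (g * P.τ (-x))⁻¹) rfl, ← modelDeriv_id (I := 𝓘(ℝ, E)) (-x)]
  · apply modelDeriv_congr
    filter_upwards [(P.τ.open_source.preimage continuous_neg).mem_nhds (x := -x)
      (by simpa using hx)] with η hη
    have h := P.τ_neg_eq_inv hη
    rw [neg_neg] at h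
    simp [h, P.τ.left_inv hη]
  · refine MDifferentiableAt.neg (MDifferentiableAt.comp (I' := 𝓘(ℝ, E)) _
      (P.mdifferentiableAt_τ_symm ?_) hmul)
    simpa [P.τ_neg_eq_inv hx] using P.τ.map_source hx
  · exact mdifferentiableAt_mul (P.mdifferentiableAt_τ_neg hx) mdifferentiableAt_const

omit [FiniteDimensional ℝ E] in
theorem mdifferentiableAt_τ_symm_inv_mul {V : Type*} [NormedAddCommGroup V] [NormedSpace ℝ V]
    {H : Type*} [TopologicalSpace H] {I : ModelWithCorners ℝ V H} {M : Type*} [TopologicalSpace M]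
    [ChartedSpace H M] {a b : M → G} {p : M} (ha : MDifferentiableAt I 𝓘(ℝ, E) a p)
    (hb : MDifferentiableAt I 𝓘(ℝ, E) b p) (h : (a p)⁻¹ * b p ∈ P.τ.target) :
    MDifferentiableAt I 𝓘(ℝ, E) (fun t => P.τ.symm ((a t)⁻¹ * b t)) p :=
  MDifferentiableAt.comp (I' := 𝓘(ℝ, E)) p (P.mdifferentiableAt_τ_symm h)
    (mdifferentiableAt_mul (mdifferentiableAt_inv ha) hb)

/-- Since `τ(x) = a⁻¹b`, applying `η ↦ τ(η)τ(x)⁻¹` to `τ⁻¹(t⁻¹b)` gives `t⁻¹a = (a⁻¹t)⁻¹`. This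
curve passes through `1` at `t = a`, where inversion has derivative `-1`; then `dτ_x` is cancelled.
-/
theorem modelDeriv_τ_symm_left {a b : G} (h : a⁻¹ * b ∈ P.τ.target) :
    modelDeriv 𝓘(ℝ, E) 𝓘(ℝ, E) (fun t => P.τ.symm (t⁻¹ * b)) a
      = -(P.dτInv (P.τ.symm (a⁻¹ * b))).comp (leftTrivModel a) := by
  set x := P.τ.symm (a⁻¹ * b) with hxdef
  have hx : x ∈ P.τ.source := P.τ.map_target h
  have hτx : P.τ x = a⁻¹ * b := P.τ.right_inv h
  have hR : MDifferentiableAt 𝓘(ℝ, E) 𝓘(ℝ, E) (fun t => P.τ.symm (t⁻¹ * b)) a :=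
    P.mdifferentiableAt_τ_symm_inv_mul mdifferentiableAt_id mdifferentiableAt_const h
  have hL : MDifferentiableAt 𝓘(ℝ, E) 𝓘(ℝ, E) (fun t => a⁻¹ * t) a :=
    mdifferentiableAt_mul mdifferentiableAt_const mdifferentiableAt_id
  have key : (P.dτ x).comp (modelDeriv 𝓘(ℝ, E) 𝓘(ℝ, E) (fun t => P.τ.symm (t⁻¹ * b)) a)
      = -leftTrivModel a := by
    rw [dτ_eq_modelDeriv, leftTrivModel_eq, ← modelDeriv_inv_of_eq_one hL (by simp),
      ← modelDeriv_comp (f := fun t => P.τ.symm (t⁻¹ * b)) hxdef.symm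
        (mdifferentiableAt_mul (P.mdifferentiableAt_τ hx) mdifferentiableAt_const) hR]
    apply modelDeriv_congr
    have hc : ContinuousAt (fun t : G => t⁻¹ * b) a :=
      (mdifferentiableAt_mul (E := E) (I := 𝓘(ℝ, E)) (mdifferentiableAt_inv mdifferentiableAt_id)
        mdifferentiableAt_const).continuousAt
    filter_upwards [hc.preimage_mem_nhds (P.τ.open_target.mem_nhds h)] with t ht
    rw [P.τ.right_inv ht, hτx]
    group
  rw [← ContinuousLinearMap.id_comp (modelDeriv _ _ _ _), ← P.dτInv_comp_dτ hx,
    ContinuousLinearMap.comp_assoc, key]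
  ext v
  simp

/-- The sign in `dτ⁻¹_{-x}` arises from moving `t` to the left: `τ(-τ⁻¹(a⁻¹t)) = t⁻¹a`, and
multiplying by `τ(-x)⁻¹ = a⁻¹b` gives `t⁻¹b = (b⁻¹t)⁻¹`, which passes through `1` at `t = b`. -/
theorem modelDeriv_τ_symm_right {a b : G} (h : a⁻¹ * b ∈ P.τ.target) :
    modelDeriv 𝓘(ℝ, E) 𝓘(ℝ, E) (fun t => P.τ.symm (a⁻¹ * t)) b
      = (P.dτInv (-P.τ.symm (a⁻¹ * b))).comp (leftTrivModel b) := by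
  set x := P.τ.symm (a⁻¹ * b) with hxdef
  have hx : x ∈ P.τ.source := P.τ.map_target h
  have hτx : P.τ x = a⁻¹ * b := P.τ.right_inv h
  have hR : MDifferentiableAt 𝓘(ℝ, E) 𝓘(ℝ, E) (fun t => P.τ.symm (a⁻¹ * t)) b :=
    P.mdifferentiableAt_τ_symm_inv_mul mdifferentiableAt_const mdifferentiableAt_id h
  have hneg : modelDeriv 𝓘(ℝ, E) 𝓘(ℝ, E) (fun t => -P.τ.symm (a⁻¹ * t)) b
      = -modelDeriv 𝓘(ℝ, E) 𝓘(ℝ, E) (fun t => P.τ.symm (a⁻¹ * t)) b :=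
    modelDeriv_eq (hasMFDerivAt_modelDeriv hR).neg
  have hL : MDifferentiableAt 𝓘(ℝ, E) 𝓘(ℝ, E) (fun t => b⁻¹ * t) b :=
    mdifferentiableAt_mul mdifferentiableAt_const mdifferentiableAt_id
  have key : (P.dτ (-x)).comp (modelDeriv 𝓘(ℝ, E) 𝓘(ℝ, E) (fun t => -P.τ.symm (a⁻¹ * t)) b)
      = -leftTrivModel b := by
    rw [dτ_eq_modelDeriv, leftTrivModel_eq, ← modelDeriv_inv_of_eq_one hL (by simp),
      ← modelDeriv_comp (f := fun t => -P.τ.symm (a⁻¹ * t)) (y := -x) (by rw [hxdef])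
        (mdifferentiableAt_mul (P.mdifferentiableAt_τ_neg hx) mdifferentiableAt_const) hR.neg]
    apply modelDeriv_congr
    have hc : ContinuousAt (fun t : G => a⁻¹ * t) b :=
      (mdifferentiableAt_mul (E := E) (I := 𝓘(ℝ, E)) mdifferentiableAt_const
        mdifferentiableAt_id).continuousAt
    filter_upwards [hc.preimage_mem_nhds (P.τ.open_target.mem_nhds h)] with t ht
    rw [P.τ_neg_eq_inv (P.τ.map_target ht), P.τ_neg_eq_inv hx, P.τ.right_inv ht, hτx]
    group
  rw [← neg_inj, ← hneg, ← ContinuousLinearMap.id_comp (modelDeriv _ _ _ _),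
    ← P.dτInv_neg_comp_dτ hx, ContinuousLinearMap.comp_assoc, key]
  ext v
  simp

/-- The derivative of `τ⁻¹(a⁻¹ b)`:
`δ τ⁻¹(a⁻¹ b) = dτ⁻¹_{-x}(b⁻¹ δb) - dτ⁻¹_x(a⁻¹ δa)` with `x = τ⁻¹(a⁻¹ b)`. -/
theorem modelDeriv_τ_symm_inv_mul {V : Type*} [NormedAddCommGroup V] [NormedSpace ℝ V]
    {H : Type*} [TopologicalSpace H] {I : ModelWithCorners ℝ V H} {M : Type*} [TopologicalSpace M]
    [ChartedSpace H M] {a b : M → G} {p : M} (ha : MDifferentiableAt I 𝓘(ℝ, E) a p)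
    (hb : MDifferentiableAt I 𝓘(ℝ, E) b p) (h : (a p)⁻¹ * b p ∈ P.τ.target) :
    modelDeriv I 𝓘(ℝ, E) (fun t => P.τ.symm ((a t)⁻¹ * b t)) p
      = ((P.dτInv (-P.τ.symm ((a p)⁻¹ * b p))).comp (leftTrivModel (b p))).comp
          (modelDeriv I 𝓘(ℝ, E) b p)
        - ((P.dτInv (P.τ.symm ((a p)⁻¹ * b p))).comp (leftTrivModel (a p))).comp
          (modelDeriv I 𝓘(ℝ, E) a p) := by
  rw [modelDeriv_comp₂ (f := fun q : G × G => P.τ.symm (q.1⁻¹ * q.2)) rfl rfl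
    (P.mdifferentiableAt_τ_symm_inv_mul mdifferentiableAt_fst mdifferentiableAt_snd h) ha hb,
    P.modelDeriv_τ_symm_left h, P.modelDeriv_τ_symm_right h]
  ext v
  simp [sub_eq_add_neg, add_comm]

end Scheme

/-- The variables `(y, Ξ, V, μ, ν, μ̌, ν)` of one time step other than its boundary data, the stage
variables `Gⁱ` being replaced by their coordinates `yⁱ = τ⁻¹(g⁻¹ Gⁱ)`. -/
abbrev StepVars (E : Type*) [NormedAddCommGroup E] [NormedSpace ℝ E] (s : ℕ) :=
  (Fin s → E) × (Fin s → E) × (Fin s → E) × (Fin s → Dual E) × (Fin s → Dual E) × Dual E × Dual E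

/-! ### One step of the action and its critical points -/

namespace Scheme

variable {E : Type*} [NormedAddCommGroup E] [NormedSpace ℝ E]
  {G : Type*} [TopologicalSpace G] [ChartedSpace E G] [Group G]
  {s N : ℕ} (P : Scheme E G s)

/-- The contribution of one time step to the functional, as a function of the boundary data
`(τ⁻¹(g_k⁻¹ g_{k+1}), ξ_k, ξ_{k+1})` and of the remaining variables of the step. -/
def stepAction (a : E × E × E) (b : StepVars E s) : ℝ :=
  P.h *
    ((∑ i : Fin s,
        (P.b i * P.ℓ (b.2.1 i, b.2.2.1 i)
          + b.2.2.2.1 i ((1 / P.h) • b.1 i - ∑ j, P.a i j • b.2.1 j)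
          + b.2.2.2.2.1 i ((1 / P.h) • (b.2.1 i - a.2.1) - ∑ j, P.a i j • b.2.2.1 j)))
      + b.2.2.2.2.2.1 ((1 / P.h) • a.1 - ∑ i, P.b i • b.2.1 i)
      + b.2.2.2.2.2.2 ((1 / P.h) • (a.2.2 - a.2.1) - ∑ i, P.b i • b.2.2.1 i))

/-- The boundary data of the step from `k` to `k + 1`. -/
def stepBase (γ : Path E G s N) (k : Fin N) : E × E × E :=
  (P.τ.symm ((γ.g k.castSucc)⁻¹ * γ.g k.succ), γ.ξ k.castSucc, γ.ξ k.succ)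

/-- The remaining variables of the step from `k` to `k + 1`. -/
def stepVars (γ : Path E G s N) (k : Fin N) : StepVars E s :=
  (fun i => P.τ.symm ((γ.g k.castSucc)⁻¹ * (γ.stage k).Gs i), (γ.stage k).Ξ, (γ.stage k).V,
    (γ.stage k).μ, (γ.stage k).ν, γ.μc k, γ.ν k)

theorem action_eq_sum_stepAction (γ : Path E G s N) :
    P.action γ = ∑ k, P.stepAction (P.stepBase γ k) (P.stepVars γ k) :=
  Finset.mul_sum _ _ _

theorem differentiable_stepAction :
    Differentiable ℝ fun q : (E × E × E) × StepVars E s => P.stepAction q.1 q.2 := by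
  have hℓ : Differentiable ℝ P.ℓ := P.ℓ_smooth.differentiable (by simp)
  unfold stepAction
  fun_prop

/-- The derivative of the functional of one step, as a function of all its variables. -/
def stepFDeriv (a : E × E × E) (b : StepVars E s) : (E × E × E) × StepVars E s →L[ℝ] ℝ :=
  fderiv ℝ (fun q : (E × E × E) × StepVars E s => P.stepAction q.1 q.2) (a, b)

theorem hasFDerivAt_stepAction (a : E × E × E) (b : StepVars E s) :
    HasFDerivAt (fun q : (E × E × E) × StepVars E s => P.stepAction q.1 q.2)
      (P.stepFDeriv a b) (a, b) :=
  (P.differentiable_stepAction (a, b)).hasFDerivAt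

theorem hasDerivAt_stepAction_line (a : E × E × E) (b : StepVars E s)
    (v : (E × E × E) × StepVars E s) :
    HasDerivAt (fun ε : ℝ => P.stepAction (a + ε • v.1) (b + ε • v.2)) (P.stepFDeriv a b v) 0 :=
  (P.hasFDerivAt_stepAction a b).hasLineDerivAt v

/-- The action is affine along the boundary data, along `μ̌` and along `y`. Only these directions
have to be computed, so the derivative of `ℓ` never appears. -/
theorem stepFDeriv_eq_of_affine {a : E × E × E} {b : StepVars E s}
    {v : (E × E × E) × StepVars E s} {c : ℝ}
    (h : ∀ ε : ℝ, P.stepAction (a + ε • v.1) (b + ε • v.2) = P.stepAction a b + ε * c) :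
    P.stepFDeriv a b v = c := by
  refine (P.hasDerivAt_stepAction_line a b v).unique ?_
  simp only [h]
  simpa using ((hasDerivAt_id (0 : ℝ)).mul_const c).const_add (P.stepAction a b)

theorem stepFDeriv_base (a δ : E × E × E) (b : StepVars E s) :
    P.stepFDeriv a b (δ, 0)
      = b.2.2.2.2.2.1 δ.1 + b.2.2.2.2.2.2 (δ.2.2 - δ.2.1) - ∑ i, b.2.2.2.2.1 i δ.2.1 := by
  refine P.stepFDeriv_eq_of_affine fun ε => ?_
  have hh : P.h ≠ 0 := P.h_pos.ne'
  have hi : ∀ i, b.2.2.2.2.1 i ((1 / P.h) • (b.2.1 i - (a.2.1 + ε • δ.2.1))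
        - ∑ j, P.a i j • b.2.2.1 j)
      = b.2.2.2.2.1 i ((1 / P.h) • (b.2.1 i - a.2.1) - ∑ j, P.a i j • b.2.2.1 j)
        + -(ε / P.h) * b.2.2.2.2.1 i δ.2.1 := by
    intro i
    simp only [map_sub, map_smul, map_add, smul_eq_mul]
    ring
  simp only [stepAction, Prod.fst_add, Prod.snd_add, Prod.smul_fst, Prod.smul_snd, smul_zero,
    add_zero, hi, ← add_assoc, Finset.sum_add_distrib, ← Finset.mul_sum]
  simp only [map_sub, map_smul, map_add, smul_eq_mul]
  field_simp
  ring

theorem stepFDeriv_μc (a : E × E × E) (b : StepVars E s) (δ : Dual E) :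
    P.stepFDeriv a b (0, 0, 0, 0, 0, 0, δ, 0)
      = δ (a.1 - P.h • ∑ i, P.b i • b.2.1 i) := by
  refine P.stepFDeriv_eq_of_affine fun ε => ?_
  have hh : P.h ≠ 0 := P.h_pos.ne'
  simp only [stepAction, Prod.fst_add, Prod.snd_add, Prod.smul_fst, Prod.smul_snd, smul_zero,
    add_zero]
  simp only [map_sub, map_smul, add_apply, smul_apply,
    smul_eq_mul]
  field_simp
  ring

theorem stepFDeriv_y (a : E × E × E) (b : StepVars E s) (δ : Fin s → E) :
    P.stepFDeriv a b (0, δ, 0) = ∑ i, b.2.2.2.1 i (δ i) := by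
  refine P.stepFDeriv_eq_of_affine fun ε => ?_
  have hh : P.h ≠ 0 := P.h_pos.ne'
  have hi : ∀ i, b.2.2.2.1 i ((1 / P.h) • (b.1 i + ε • δ i) - ∑ j, P.a i j • b.2.1 j)
      = b.2.2.2.1 i ((1 / P.h) • b.1 i - ∑ j, P.a i j • b.2.1 j)
        + ε / P.h * b.2.2.2.1 i (δ i) := by
    intro i
    simp only [map_sub, map_smul, map_add, smul_eq_mul]
    ring
  simp only [stepAction, Prod.fst_add, Prod.snd_add, Prod.smul_fst, Prod.smul_snd, smul_zero,
    add_zero, Pi.add_apply, Pi.smul_apply, hi, Finset.sum_add_distrib, ← Finset.mul_sum]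
  field_simp
  ring

/-- The step from `k` to `k + 1` of a discrete path is critical for variations of its internal
variables and multipliers. -/
structure IsCriticalStep (γ : Path E G s N) (k : Fin N) : Prop where
  mem_target : (γ.g k.castSucc)⁻¹ * γ.g k.succ ∈ P.τ.target
  stage_mem_target : ∀ i, (γ.g k.castSucc)⁻¹ * (γ.stage k).Gs i ∈ P.τ.target
  stepFDeriv_eq_zero : ∀ δ, P.stepFDeriv (P.stepBase γ k) (P.stepVars γ k) (0, δ) = 0

/-- The variation of the internal variables and multipliers of all steps in the directions `δ`. -/
def internalVariation (γ : Path E G s N) (δ : Fin N → StepVars E s) (ε : ℝ) : Path E G s N where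
  g := γ.g
  ξ := γ.ξ
  μc k := γ.μc k + ε • (δ k).2.2.2.2.2.1
  ν k := γ.ν k + ε • (δ k).2.2.2.2.2.2
  stage k :=
    { Gs := fun i => γ.g k.castSucc *
        P.τ (P.τ.symm ((γ.g k.castSucc)⁻¹ * (γ.stage k).Gs i) + ε • (δ k).1 i)
      Ξ := (γ.stage k).Ξ + ε • (δ k).2.1
      V := (γ.stage k).V + ε • (δ k).2.2.1
      μ := (γ.stage k).μ + ε • (δ k).2.2.2.1
      ν := (γ.stage k).ν + ε • (δ k).2.2.2.2.1 }

variable {P} in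
theorem isVariation_internalVariation [LieGroup 𝓘(ℝ, E) ∞ G] {γ : Path E G s N}
    (hγ : P.Admissible γ) (δ : Fin N → StepVars E s) :
    IsVariation γ (P.internalVariation γ δ) := by
  have hline : ∀ {W : Type _} [NormedAddCommGroup W] [NormedSpace ℝ W] (x v : W),
      ContDiffAt ℝ ∞ (fun ε : ℝ => x + ε • v) 0 := fun x v =>
    contDiffAt_const.add (contDiffAt_id.smul contDiffAt_const)
  refine
    { at_zero := ?_
      g_zero := fun _ => rfl
      g_last := fun _ => rfl
      ξ_zero := fun _ => rfl
      ξ_last := fun _ => rfl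
      g_smooth := fun _ => contMDiffAt_const
      ξ_smooth := fun _ => contDiffAt_const
      μc_smooth := fun _ => hline _ _
      ν_smooth := fun _ => hline _ _
      stageG_smooth := fun k i => ?_
      stageΞ_smooth := fun k i => hline _ _
      stageV_smooth := fun k i => hline _ _
      stageμ_smooth := fun k i => hline _ _
      stageν_smooth := fun k i => hline _ _ }
  · have h : ∀ k i, γ.g k.castSucc *
        P.τ (P.τ.symm ((γ.g k.castSucc)⁻¹ * (γ.stage k).Gs i) + (0 : ℝ) • (δ k).1 i)
          = (γ.stage k).Gs i := by
      intro k i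
      rw [zero_smul, add_zero, P.τ.right_inv ((hγ k).2 i), mul_inv_cancel_left]
    simp only [internalVariation, h]
    simp only [zero_smul, add_zero]
  · refine contMDiffAt_const.mul (ContMDiffAt.comp (I' := 𝓘(ℝ, E)) 0 (P.contMDiffAt_τ ?_)
      (hline _ _).contMDiffAt)
    simpa using P.τ.map_target ((hγ k).2 i)

/-- In the `y` coordinates the variation is a straight line, as long as `y + εδ` stays in the source
of `τ`; hence only for small `ε`. -/
theorem eventually_stepVars_internalVariation {γ : Path E G s N} (hγ : P.Admissible γ)
    (δ : Fin N → StepVars E s) (k : Fin N) :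
    ∀ᶠ ε : ℝ in 𝓝 0, P.stepVars (P.internalVariation γ δ ε) k = P.stepVars γ k + ε • δ k := by
  have h : ∀ᶠ ε : ℝ in 𝓝 0, ∀ i,
      P.τ.symm ((γ.g k.castSucc)⁻¹ * (γ.stage k).Gs i) + ε • (δ k).1 i ∈ P.τ.source := by
    refine eventually_all.2 fun i => ?_
    have hc : Continuous fun ε : ℝ =>
        P.τ.symm ((γ.g k.castSucc)⁻¹ * (γ.stage k).Gs i) + ε • (δ k).1 i := by fun_prop
    exact hc.continuousAt.preimage_mem_nhds (P.τ.open_source.mem_nhds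
      (by simpa using P.τ.map_target ((hγ k).2 i)))
  filter_upwards [h] with ε hε
  refine Prod.ext (funext fun i => ?_) rfl
  simp only [stepVars, internalVariation, inv_mul_cancel_left]
  exact P.τ.left_inv (hε i)

variable {P}

/-- With one step the action is a single summand, and internal variations leave both nodes fixed, so
they are allowed variations in every direction `δ`. -/
theorem IsSolution.isCriticalStep [LieGroup 𝓘(ℝ, E) ∞ G] {γ : Path E G s 1} (h : P.IsSolution γ)
    (k : Fin 1) : P.IsCriticalStep γ k where
  mem_target := (h.1 k).1
  stage_mem_target := (h.1 k).2
  stepFDeriv_eq_zero δ := by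
    have h₁ := h.2 _ (isVariation_internalVariation h.1 fun _ => δ)
    have h₂ := P.hasDerivAt_stepAction_line (P.stepBase γ k) (P.stepVars γ k) (0, δ)
    refine h₂.unique (h₁.congr_of_eventuallyEq ?_)
    filter_upwards [P.eventually_stepVars_internalVariation h.1 (fun _ => δ) k] with ε hε
    obtain rfl : k = 0 := Subsingleton.elim _ _
    rw [action_eq_sum_stepAction, Fin.sum_univ_one, hε, smul_zero, add_zero]
    rfl

namespace IsCriticalStep

variable {γ : Path E G s N} {k : Fin N}

/-- The constraint enforced by the multiplier `μ̌`. -/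
theorem τ_symm_eq (h : P.IsCriticalStep γ k) :
    P.τ.symm ((γ.g k.castSucc)⁻¹ * γ.g k.succ) = P.h • P.average (γ.stage k) := by
  rw [← sub_eq_zero]
  refine SeparatingDual.eq_zero_of_forall_dual_eq_zero (R := ℝ) fun δ => ?_
  have := h.stepFDeriv_eq_zero (0, 0, 0, 0, 0, δ, 0)
  rwa [P.stepFDeriv_μc] at this

/-- The stage `Gⁱ` enters the action only through its pairing with `μⁱ`, so varying it alone forces
`μⁱ` to vanish. The sum over stages in the definition of `μ_0` therefore contributes nothing. -/
theorem μ_eq_zero (h : P.IsCriticalStep γ k) (i : Fin s) : (γ.stage k).μ i = 0 := by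
  ext v
  have := h.stepFDeriv_eq_zero (Pi.single i v, 0)
  rw [P.stepFDeriv_y, Finset.sum_eq_single i] at this
  · rwa [Pi.single_eq_same] at this
  · intro j _ hj
    simp [hj]
  · simp

theorem stepFDeriv_apply (h : P.IsCriticalStep γ k) (v : (E × E × E) × StepVars E s) :
    P.stepFDeriv (P.stepBase γ k) (P.stepVars γ k) v
      = γ.μc k v.1.1 + γ.ν k (v.1.2.2 - v.1.2.1) - ∑ i, (γ.stage k).ν i v.1.2.1 := by
  have hv : v = (v.1, 0) + (0, v.2) := by simp
  conv_lhs => rw [hv]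
  rw [map_add, h.stepFDeriv_eq_zero, add_zero, P.stepFDeriv_base]
  rfl

end IsCriticalStep

end Scheme

/-! ### First variation of the action along families of paths -/

section Families

variable {V : Type*} [NormedAddCommGroup V] [NormedSpace ℝ V] {H : Type*} [TopologicalSpace H]
  {I : ModelWithCorners ℝ V H} {M : Type*} [TopologicalSpace M] [ChartedSpace H M]

theorem mdifferentiableAt_pi_space {ι : Type*} [Fintype ι] {W : Type*} [NormedAddCommGroup W]
    [NormedSpace ℝ W] {f : M → ι → W} {p : M}
    (h : ∀ i, MDifferentiableAt I 𝓘(ℝ, W) (fun t => f t i) p) :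
    MDifferentiableAt I 𝓘(ℝ, ι → W) f p := by
  rw [mdifferentiableAt_iff]
  exact ⟨continuousAt_pi.2 fun i => (h i).continuousAt,
    differentiableWithinAt_pi.2 fun i => ((mdifferentiableAt_iff _ _).1 (h i)).2⟩

variable {E : Type*} [NormedAddCommGroup E] [NormedSpace ℝ E]
  {G : Type*} [TopologicalSpace G] [ChartedSpace E G] [Group G]
  {s N : ℕ}

variable (I) in
/-- A family of discrete paths all of whose components are differentiable at `p`. -/
structure IsDifferentiableFamilyAt (c : M → Path E G s N) (p : M) : Prop where
  g : ∀ k, MDifferentiableAt I 𝓘(ℝ, E) (fun t => (c t).g k) p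
  ξ : ∀ k, MDifferentiableAt I 𝓘(ℝ, E) (fun t => (c t).ξ k) p
  μc : ∀ k, MDifferentiableAt I 𝓘(ℝ, Dual E) (fun t => (c t).μc k) p
  ν : ∀ k, MDifferentiableAt I 𝓘(ℝ, Dual E) (fun t => (c t).ν k) p
  stageG : ∀ k i, MDifferentiableAt I 𝓘(ℝ, E) (fun t => ((c t).stage k).Gs i) p
  stageΞ : ∀ k i, MDifferentiableAt I 𝓘(ℝ, E) (fun t => ((c t).stage k).Ξ i) p
  stageV : ∀ k i, MDifferentiableAt I 𝓘(ℝ, E) (fun t => ((c t).stage k).V i) p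
  stageμ : ∀ k i, MDifferentiableAt I 𝓘(ℝ, Dual E) (fun t => ((c t).stage k).μ i) p
  stageν : ∀ k i, MDifferentiableAt I 𝓘(ℝ, Dual E) (fun t => ((c t).stage k).ν i) p

omit [Group G] in
theorem IsVariation.isDifferentiableFamilyAt {γ : Path E G s N} {c : ℝ → Path E G s N}
    (h : IsVariation γ c) : IsDifferentiableFamilyAt 𝓘(ℝ, ℝ) c 0 where
  g k := (h.g_smooth k).mdifferentiableAt (by simp)
  ξ k := ((h.ξ_smooth k).differentiableAt (by simp)).mdifferentiableAt
  μc k := ((h.μc_smooth k).differentiableAt (by simp)).mdifferentiableAt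
  ν k := ((h.ν_smooth k).differentiableAt (by simp)).mdifferentiableAt
  stageG k i := (h.stageG_smooth k i).mdifferentiableAt (by simp)
  stageΞ k i := ((h.stageΞ_smooth k i).differentiableAt (by simp)).mdifferentiableAt
  stageV k i := ((h.stageV_smooth k i).differentiableAt (by simp)).mdifferentiableAt
  stageμ k i := ((h.stageμ_smooth k i).differentiableAt (by simp)).mdifferentiableAt
  stageν k i := ((h.stageν_smooth k i).differentiableAt (by simp)).mdifferentiableAt

variable (I) in
/-- The derivative of the `j`-th node of a family of paths, paired with the momenta `(m, n)`:
`⟨m, g_j⁻¹ δg_j⟩ + ⟨n, δξ_j⟩`. -/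
def nodePairing (c : M → Path E G s N) (p : M) (j : Fin (N + 1)) (m n : Dual E) : V →L[ℝ] ℝ :=
  (m.comp (leftTrivModel ((c p).g j))).comp (modelDeriv I 𝓘(ℝ, E) (fun t => (c t).g j) p)
    + n.comp (modelDeriv I 𝓘(ℝ, E) (fun t => (c t).ξ j) p)

namespace Scheme

variable (P : Scheme E G s)

/-- The momenta at the initial point of the step from `k` to `k + 1`. -/
def initialMomenta (γ : Path E G s N) (k : Fin N) : Dual E × Dual E :=
  ((γ.μc k).comp (P.dτInv (P.h • P.average (γ.stage k)))
      + ∑ i, ((γ.stage k).μ i).comp (P.dτInv (P.h • P.theta (γ.stage k) i)),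
    γ.ν k + ∑ i, (γ.stage k).ν i)

/-- The momenta at the end point of the step from `k` to `k + 1`. -/
def finalMomenta (γ : Path E G s N) (k : Fin N) : Dual E × Dual E :=
  ((γ.μc k).comp (P.dτInv (-(P.h • P.average (γ.stage k)))), γ.ν k)

variable [LieGroup 𝓘(ℝ, E) ∞ G] {P}

theorem mdifferentiableAt_stepBase {c : M → Path E G s N} {p : M}
    (hc : IsDifferentiableFamilyAt I c p) {k : Fin N} (hk : P.IsCriticalStep (c p) k) :
    MDifferentiableAt I 𝓘(ℝ, E × E × E) (fun t => P.stepBase (c t) k) p :=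
  (P.mdifferentiableAt_τ_symm_inv_mul (hc.g _) (hc.g _) hk.mem_target).prodMk_space
    ((hc.ξ _).prodMk_space (hc.ξ _))

theorem mdifferentiableAt_stepVars {c : M → Path E G s N} {p : M}
    (hc : IsDifferentiableFamilyAt I c p) {k : Fin N} (hk : P.IsCriticalStep (c p) k) :
    MDifferentiableAt I 𝓘(ℝ, StepVars E s) (fun t => P.stepVars (c t) k) p :=
  (mdifferentiableAt_pi_space fun i =>
      P.mdifferentiableAt_τ_symm_inv_mul (hc.g _) (hc.stageG k i)
        (hk.stage_mem_target i)).prodMk_space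
    ((mdifferentiableAt_pi_space (hc.stageΞ k)).prodMk_space
      ((mdifferentiableAt_pi_space (hc.stageV k)).prodMk_space
        ((mdifferentiableAt_pi_space (hc.stageμ k)).prodMk_space
          ((mdifferentiableAt_pi_space (hc.stageν k)).prodMk_space
            ((hc.μc k).prodMk_space (hc.ν k))))))

variable [FiniteDimensional ℝ E]

/-- Criticality is needed at `p` only: internal directions drop out of the chain rule, leaving `μ̌`
paired with `δτ⁻¹(g_k⁻¹ g_{k+1})` and the `ν` terms. Moving `dτ⁻¹_{∓hΞ}` onto `μ̌` produces the
momenta at the two ends. -/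
theorem hasMFDerivAt_stepAction_family {c : M → Path E G s N} {p : M}
    (hc : IsDifferentiableFamilyAt I c p) {k : Fin N} (hk : P.IsCriticalStep (c p) k) :
    HasMFDerivAt I 𝓘(ℝ, ℝ) (fun t => P.stepAction (P.stepBase (c t) k) (P.stepVars (c t) k)) p
      (nodePairing I c p k.succ (P.finalMomenta (c p) k).1 (P.finalMomenta (c p) k).2
        - nodePairing I c p k.castSucc (P.initialMomenta (c p) k).1 (P.initialMomenta (c p) k).2 :
          V →L[ℝ] ℝ) := by
  have hB := mdifferentiableAt_stepBase hc hk
  have hV := mdifferentiableAt_stepVars hc hk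
  have hcomp : HasMFDerivAt I 𝓘(ℝ, ℝ)
      (fun t => P.stepAction (P.stepBase (c t) k) (P.stepVars (c t) k)) p
      ((P.stepFDeriv (P.stepBase (c p) k) (P.stepVars (c p) k)).comp
        (modelDeriv I 𝓘(ℝ, (E × E × E) × StepVars E s)
          (fun t => (P.stepBase (c t) k, P.stepVars (c t) k)) p) : V →L[ℝ] ℝ) :=
    HasMFDerivAt.comp (I' := 𝓘(ℝ, (E × E × E) × StepVars E s))
      (f := fun t => (P.stepBase (c t) k, P.stepVars (c t) k))
      (g := fun q : (E × E × E) × StepVars E s => P.stepAction q.1 q.2) p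
      (P.hasFDerivAt_stepAction _ _).hasMFDerivAt (hasMFDerivAt_modelDeriv (hB.prodMk_space hV))
  refine hcomp.congr_mfderiv ?_
  have hq := P.mdifferentiableAt_τ_symm_inv_mul (hc.g k.castSucc) (hc.g k.succ) hk.mem_target
  have hD : modelDeriv I 𝓘(ℝ, E × E × E) (fun t => P.stepBase (c t) k) p = _ :=
    modelDeriv_prodMk_space hq ((hc.ξ _).prodMk_space (hc.ξ _))
  rw [P.modelDeriv_τ_symm_inv_mul (hc.g k.castSucc) (hc.g k.succ) hk.mem_target,
    modelDeriv_prodMk_space (hc.ξ _) (hc.ξ _), hk.τ_symm_eq] at hD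
  rw [modelDeriv_prodMk_space hB hV, hD]
  refine ContinuousLinearMap.ext fun v => ?_
  refine (hk.stepFDeriv_apply _).trans ?_
  simp [nodePairing, initialMomenta, finalMomenta, hk.μ_eq_zero]
  ring

/-- The variation of the functional along a family of discrete paths with critical steps and
matching momenta `ζ j` at the nodes. -/
theorem hasMFDerivAt_action_family {c : M → Path E G s N} {p : M}
    (hc : IsDifferentiableFamilyAt I c p) (hk : ∀ k, P.IsCriticalStep (c p) k)
    (ζ : Fin (N + 1) → Dual E × Dual E) (hi : ∀ k, P.initialMomenta (c p) k = ζ k.castSucc)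
    (hf : ∀ k, P.finalMomenta (c p) k = ζ k.succ) :
    HasMFDerivAt I 𝓘(ℝ, ℝ) (fun t => P.action (c t)) p
      (nodePairing I c p (Fin.last N) (ζ (Fin.last N)).1 (ζ (Fin.last N)).2
        - nodePairing I c p 0 (ζ 0).1 (ζ 0).2 : V →L[ℝ] ℝ) := by
  have h := HasMFDerivAt.sum (t := Finset.univ) fun k _ => hasMFDerivAt_stepAction_family hc (hk k)
  have hfun : (fun t => P.action (c t))
      = ∑ k, fun t => P.stepAction (P.stepBase (c t) k) (P.stepVars (c t) k) := by
    ext t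
    rw [action_eq_sum_stepAction, Finset.sum_apply]
  rw [hfun]
  refine h.congr_mfderiv ?_
  simp only [hi, hf]
  refine (Finset.sum_sub_distrib (G := V →L[ℝ] ℝ) _ _).trans ?_
  -- Telescoping: the sum over all nodes is split once at its first term and once at its last.
  have h₁ := Fin.sum_univ_succ fun j => nodePairing I c p j (ζ j).1 (ζ j).2
  have h₂ := Fin.sum_univ_castSucc fun j => nodePairing I c p j (ζ j).1 (ζ j).2
  rw [h₁] at h₂
  rw [sub_eq_sub_iff_add_eq_add, add_comm, h₂, add_comm]

end Scheme

end Families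

/-! ### Smooth dependence of derivatives on the base point -/

section Smoothness

variable {V : Type*} [NormedAddCommGroup V] [NormedSpace ℝ V]
  {E : Type*} [NormedAddCommGroup E] [NormedSpace ℝ E]
  {G : Type*} [TopologicalSpace G] [ChartedSpace E G] [IsManifold 𝓘(ℝ, E) ∞ G]

/-- The derivative of `f x` at `x` depends smoothly on `x` if `f` is smooth and all values `f x x`
agree. -/
theorem contDiffAt_modelDeriv_diag {f : V → V → G} {x₀ : V} {g₀ : G}
    (hf : ContMDiffAt (𝓘(ℝ, V).prod 𝓘(ℝ, V)) 𝓘(ℝ, E) ∞ (Function.uncurry f) (x₀, x₀))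
    (h : ∀ᶠ x in 𝓝 x₀, f x x = g₀) :
    ContDiffAt ℝ ∞ (fun x => modelDeriv 𝓘(ℝ, V) 𝓘(ℝ, E) (f x) x) x₀ := by
  have : IsManifold 𝓘(ℝ, E) 1 G := IsManifold.of_le (n := ∞) (by simp)
  have h₁ := (ContMDiffAt.mfderiv (m := ∞) f (fun x => x) hf contMDiffAt_id (by simp)).contDiffAt
  refine h₁.congr_of_eventuallyEq ?_
  filter_upwards [h] with x hx
  have h0 : f x₀ x₀ = g₀ := h.self_of_nhds
  -- Because `f x x` stays at `g₀`, the tangent coordinate change on the target side is that of the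
  -- chart at `g₀` with itself, hence the identity, and the derivative in coordinates is the plain
  -- one.
  have heq := inTangentCoordinates_eq (I := 𝓘(ℝ, V)) (I' := 𝓘(ℝ, E)) (fun x : V => x)
    (fun x => f x x) (fun x => modelDeriv 𝓘(ℝ, V) 𝓘(ℝ, E) (f x) x) (x₀ := x₀) (x := x)
    (Set.mem_univ x) (by rw [hx, h0]; exact mem_chart_source E _)
  rw [hx, h0, tangentBundleCore_coordChange_model_space] at heq
  refine Eq.trans ?_ heq.symm
  ext v
  exact ((tangentBundleCore 𝓘(ℝ, E) G).coordChange_self (achart E g₀) g₀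
    (mem_chart_source E g₀) _).symm

end Smoothness

/-! ### Coordinates on `T*(TG)` and pullbacks of `θ` -/

section Cot

variable {E : Type*} [NormedAddCommGroup E] [NormedSpace ℝ E]
  {G : Type*} [TopologicalSpace G] [ChartedSpace E G]

theorem contMDiff_cot_g :
    ContMDiff (modelCot E) 𝓘(ℝ, E) ∞ fun z : CotTG E G => z.1 :=
  contMDiff_fst

theorem contMDiff_cot_ξ :
    ContMDiff (modelCot E) 𝓘(ℝ, E) ∞ fun z : CotTG E G => z.2.1 :=
  ContMDiff.comp (I' := 𝓘(ℝ, E × Dual E × Dual E)) contDiff_fst.contMDiff contMDiff_snd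

theorem contMDiff_cot_μ :
    ContMDiff (modelCot E) 𝓘(ℝ, Dual E) ∞ fun z : CotTG E G => z.2.2.1 :=
  ContMDiff.comp (I' := 𝓘(ℝ, E × Dual E × Dual E)) (f := fun z : CotTG E G => z.2)
    (g := fun q : E × Dual E × Dual E => q.2.1)
    (contDiff_fst.comp contDiff_snd).contMDiff contMDiff_snd

theorem contMDiff_cot_ν :
    ContMDiff (modelCot E) 𝓘(ℝ, Dual E) ∞ fun z : CotTG E G => z.2.2.2 :=
  ContMDiff.comp (I' := 𝓘(ℝ, E × Dual E × Dual E)) (f := fun z : CotTG E G => z.2)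
    (g := fun q : E × Dual E × Dual E => q.2.2)
    (contDiff_snd.comp contDiff_snd).contMDiff contMDiff_snd

variable [Group G] {V : Type*} [NormedAddCommGroup V] [NormedSpace ℝ V] {H : Type*}
  [TopologicalSpace H] {I : ModelWithCorners ℝ V H} {M : Type*} [TopologicalSpace M]
  [ChartedSpace H M]

/-- The canonical one-form, as a map whose type does not depend on the point. -/
def canonicalOneFormModel (z : CotTG E G) : ModelCotSpace E →L[ℝ] ℝ := canonicalOneForm z

/-- This puts the pullback of `θ` in the shape of the boundary terms of the first variation. -/
theorem canonicalOneFormModel_comp {f : M → CotTG E G} {p : M}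
    (hf : MDifferentiableAt I (modelCot E) f p) :
    (canonicalOneFormModel (f p)).comp (modelDeriv I (modelCot E) f p)
      = (((f p).μ).comp (leftTrivModel (f p).g)).comp (modelDeriv I 𝓘(ℝ, E) (fun t => (f t).g) p)
        + ((f p).ν).comp (modelDeriv I 𝓘(ℝ, E) (fun t => (f t).ξ) p) := by
  have hg := contMDiff_cot_g.mdifferentiable (by simp) (f p)
  have hξ := contMDiff_cot_ξ.mdifferentiable (by simp) (f p)
  have hproj : modelDeriv (modelCot E) (modelTG E) (CotTG.proj : CotTG E G → TG E G) (f p) = _ :=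
    modelDeriv_prodMk hg hξ
  have h : canonicalOneFormModel (f p)
      = (((f p).μ.comp (leftTrivModel (f p).g)).comp (ContinuousLinearMap.fst ℝ E E) +
        (f p).ν.comp (ContinuousLinearMap.snd ℝ E E)).comp
          (modelDeriv (modelCot E) (modelTG E) (CotTG.proj : CotTG E G → TG E G) (f p)) := rfl
  rw [h, hproj, modelDeriv_comp (g := fun z : CotTG E G => z.1) rfl hg hf,
    modelDeriv_comp (g := fun z : CotTG E G => z.2.1) rfl hξ hf]
  rfl

end Cot

/-! ### Trajectories of the discrete flow -/

namespace Scheme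

variable {E : Type*} [NormedAddCommGroup E] [NormedSpace ℝ E]
  {G : Type*} [TopologicalSpace G] [ChartedSpace E G] [Group G] [LieGroup 𝓘(ℝ, E) ∞ G]
  {s : ℕ} {P : Scheme E G s}

/-- The map `(ξ, η) ↦ τ(η)τ(ξ)⁻¹` equals `1` on the diagonal. The result makes `μ̌ = (dτ_{-hΞ})* μ`
differentiable in the initial conditions. -/
theorem contDiffAt_dτ_neg (P : Scheme E G s) {x : E} (hx : x ∈ P.τ.source) :
    ContDiffAt ℝ ∞ P.dτ (-x) := by
  have hτ := P.contMDiffAt_τ_neg hx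
  refine contDiffAt_modelDeriv_diag (f := fun ξ η => P.τ η * (P.τ ξ)⁻¹) (g₀ := 1) ?_
    (Eventually.of_forall fun ξ => by simp)
  exact (hτ.comp (-x, -x) contMDiffAt_snd).mul (hτ.comp (-x, -x) contMDiffAt_fst).inv

variable {D : Set (CotTG E G)} {F : CotTG E G → CotTG E G} {w : CotTG E G → Stages E G s}

namespace IsDiscreteFlow

omit [LieGroup 𝓘(ℝ, E) ∞ G] in
theorem contMDiffAt_F (hF : P.IsDiscreteFlow D F w) {z : CotTG E G} (hz : z ∈ D) :
    ContMDiffAt (modelCot E) (modelCot E) ∞ F z :=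
  hF.F_smooth.contMDiffAt (hF.isOpen.mem_nhds hz)

omit [LieGroup 𝓘(ℝ, E) ∞ G] in
theorem contMDiffAt_iterate (hF : P.IsDiscreteFlow D F w) {z : CotTG E G} {k : ℕ}
    (hz : ∀ j < k, F^[j] z ∈ D) : ContMDiffAt (modelCot E) (modelCot E) ∞ F^[k] z := by
  induction k with
  | zero => exact contMDiffAt_id
  | succ k ih =>
    rw [Function.iterate_succ']
    exact (hF.contMDiffAt_F (hz k k.lt_succ_self)).comp z
      (ih fun j hj => hz j (hj.trans k.lt_succ_self))

/-- Step `k` carries the same data as the one-step trajectory from `F^k(z)`, up to rewriting `F^[k +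
1] z` as `F^[1] (F^[k] z)`. -/
theorem isCriticalStep_trajectory (hF : P.IsDiscreteFlow D F w) {N : ℕ} {z : CotTG E G} (k : Fin N)
    (hz : F^[(k : ℕ)] z ∈ D) : P.IsCriticalStep (P.trajectory F w N z) k := by
  have h := (hF.solution _ hz).isCriticalStep 0
  have e : F^[(k : ℕ) + 1] z = F^[1] (F^[(k : ℕ)] z) := Function.iterate_succ_apply' F k z
  have hg : (P.trajectory F w N z).g k.succ = (P.trajectory F w 1 (F^[(k : ℕ)] z)).g 1 :=
    congrArg CotTG.g e
  have hb : P.stepBase (P.trajectory F w N z) k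
      = P.stepBase (P.trajectory F w 1 (F^[(k : ℕ)] z)) 0 := by
    simp only [stepBase, hg]
    exact Prod.ext rfl (Prod.ext rfl (congrArg CotTG.ξ e))
  have hv : P.stepVars (P.trajectory F w N z) k
      = P.stepVars (P.trajectory F w 1 (F^[(k : ℕ)] z)) 0 := by
    simp only [stepVars, trajectory, e]
    rfl
  refine ⟨?_, h.stage_mem_target, ?_⟩
  · rw [hg]
    exact h.mem_target
  · rw [hb, hv]
    exact h.stepFDeriv_eq_zero

omit [LieGroup 𝓘(ℝ, E) ∞ G] in
theorem initialMomenta_trajectory (hF : P.IsDiscreteFlow D F w) {N : ℕ} {z : CotTG E G}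
    (k : Fin N) (hz : F^[(k : ℕ)] z ∈ D) :
    P.initialMomenta (P.trajectory F w N z) k = (F^[(k : ℕ)] z).2.2 := by
  have h : (P.initialMomenta (P.trajectory F w 1 (F^[(k : ℕ)] z)) 0) = (F^[(k : ℕ)] z).2.2 :=
    congrArg (fun y : CotTG E G => y.2.2) (hF.initial_eq _ hz)
  rw [← h]
  have e : F^[(k : ℕ) + 1] z = F^[1] (F^[(k : ℕ)] z) := Function.iterate_succ_apply' F k z
  simp only [initialMomenta, trajectory, e]
  rfl

omit [LieGroup 𝓘(ℝ, E) ∞ G] in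
theorem finalMomenta_trajectory (hF : P.IsDiscreteFlow D F w) {N : ℕ} {z : CotTG E G}
    (k : Fin N) (hz : F^[(k : ℕ)] z ∈ D) :
    P.finalMomenta (P.trajectory F w N z) k = (F^[(k : ℕ) + 1] z).2.2 := by
  have h : (P.finalMomenta (P.trajectory F w 1 (F^[(k : ℕ)] z)) 0) = (F (F^[(k : ℕ)] z)).2.2 :=
    congrArg (fun y : CotTG E G => y.2.2) (hF.node_eq _ hz)
  rw [Function.iterate_succ_apply', ← h]
  have e : F^[(k : ℕ) + 1] z = F^[1] (F^[(k : ℕ)] z) := Function.iterate_succ_apply' F k z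
  simp only [finalMomenta, trajectory, e]
  rfl

omit [LieGroup 𝓘(ℝ, E) ∞ G] in
theorem initial_trajectory (hF : P.IsDiscreteFlow D F w) {N : ℕ} [NeZero N] {z : CotTG E G}
    (hz : z ∈ D) : P.initial (P.trajectory F w N z) = z := by
  have h := hF.initialMomenta_trajectory (N := N) 0 (by simpa using hz)
  refine Prod.ext ?_ (Prod.ext ?_ ?_)
  · simp [initial, trajectory]
  · simp [initial, trajectory]
  · exact h.trans (by simp)

omit [LieGroup 𝓘(ℝ, E) ∞ G] in
theorem node_trajectory (hF : P.IsDiscreteFlow D F w) {N : ℕ} {z : CotTG E G} (k : Fin N)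
    (hz : F^[(k : ℕ)] z ∈ D) : P.node (P.trajectory F w N z) k = F^[(k : ℕ) + 1] z :=
  Prod.ext rfl (Prod.ext rfl (hF.finalMomenta_trajectory k hz))

theorem isDifferentiableFamilyAt_trajectory (hF : P.IsDiscreteFlow D F w) {N : ℕ} {z : CotTG E G}
    (hz : ∀ k < N, F^[k] z ∈ D) :
    IsDifferentiableFamilyAt (modelCot E) (P.trajectory F w N) z := by
  have hit : ∀ k ≤ N, ContMDiffAt (modelCot E) (modelCot E) ∞ F^[k] z := fun k hk =>
    hF.contMDiffAt_iterate fun j hj => hz j (hj.trans_le hk)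
  have hD : ∀ k : Fin N, D ∈ 𝓝 (F^[(k : ℕ)] z) := fun k => hF.isOpen.mem_nhds (hz k k.2)
  have hk : ∀ k : Fin N, ContMDiffAt (modelCot E) (modelCot E) ∞ F^[(k : ℕ)] z := fun k =>
    hit k k.2.le
  have hΞ : ∀ (k : Fin N) i,
      ContMDiffAt (modelCot E) 𝓘(ℝ, E) ∞ (fun y => (w (F^[(k : ℕ)] y)).Ξ i) z := fun k i =>
    ((hF.Ξ_smooth i).contMDiffAt (hD k)).comp z (hk k)
  refine
    { g := fun k => ?_
      ξ := fun k => ?_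
      μc := fun k => ?_
      ν := fun k => ?_
      stageG := fun k i => ?_
      stageΞ := fun k i => (hΞ k i).mdifferentiableAt (by simp)
      stageV := fun k i => ?_
      stageμ := fun k i => ?_
      stageν := fun k i => ?_ }
  · exact (contMDiff_cot_g.contMDiffAt.comp z (hit k k.is_le)).mdifferentiableAt (by simp)
  · exact (contMDiff_cot_ξ.contMDiffAt.comp z (hit k k.is_le)).mdifferentiableAt (by simp)
  · refine MDifferentiableAt.clm_comp
      ((contMDiff_cot_μ.contMDiffAt.comp z (hit (k + 1) k.2)).mdifferentiableAt (by simp)) ?_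
    have hcrit := hF.isCriticalStep_trajectory k (hz k k.2)
    -- The constraint identifies `hΞ` with a value of `τ⁻¹`, which places it in the source.
    have hx : P.h • P.average (w (F^[(k : ℕ)] z)) ∈ P.τ.source := by
      have := P.τ.map_target hcrit.mem_target
      rwa [hcrit.τ_symm_eq] at this
    have havg : MDifferentiableAt (modelCot E) 𝓘(ℝ, E)
        (fun y => -(P.h • P.average (w (F^[(k : ℕ)] y)))) z := by
      refine (MDifferentiableAt.const_smul ?_ P.h).neg
      have := MDifferentiableAt.sum (t := Finset.univ) (I := modelCot E) (z := z)
        (f := fun j y => P.b j • (w (F^[(k : ℕ)] y)).Ξ j)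
        fun j _ => ((hΞ k j).mdifferentiableAt (by simp)).const_smul (P.b j)
      convert this using 1
      ext y
      simp [average]
    exact ((P.contDiffAt_dτ_neg hx).differentiableAt (by simp)).mdifferentiableAt.comp z havg
  · exact (contMDiff_cot_ν.contMDiffAt.comp z (hit (k + 1) k.2)).mdifferentiableAt (by simp)
  · exact (((hF.G_smooth i).contMDiffAt (hD k)).comp z (hk k)).mdifferentiableAt (by simp)
  · exact (((hF.V_smooth i).contMDiffAt (hD k)).comp z (hk k)).mdifferentiableAt (by simp)
  · exact (((hF.μ_smooth i).contMDiffAt (hD k)).comp z (hk k)).mdifferentiableAt (by simp)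
  · exact (((hF.ν_smooth i).contMDiffAt (hD k)).comp z (hk k)).mdifferentiableAt (by simp)

variable [FiniteDimensional ℝ E]

/-- The momenta of consecutive steps agree, both being those of `F^k(z)`, so the interior boundary
terms cancel; the outer ones vanish because the end nodes are fixed. -/
theorem isSolution_trajectory (hF : P.IsDiscreteFlow D F w) {N : ℕ} {z : CotTG E G}
    (hz : ∀ k < N, F^[k] z ∈ D) : P.IsSolution (P.trajectory F w N z) := by
  have hcrit := fun k : Fin N => hF.isCriticalStep_trajectory k (hz k k.2)
  refine ⟨fun k => ⟨(hcrit k).mem_target, (hcrit k).stage_mem_target⟩, fun c hc => ?_⟩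
  have h := hasMFDerivAt_action_family (P := P) hc.isDifferentiableFamilyAt
    (by rw [hc.at_zero]; exact hcrit) (fun j => (F^[(j : ℕ)] z).2.2)
    (fun k => by rw [hc.at_zero]; exact hF.initialMomenta_trajectory k (hz k k.2))
    (fun k => by rw [hc.at_zero]; exact hF.finalMomenta_trajectory k (hz k k.2))
  have h₀ : ∀ m n, nodePairing 𝓘(ℝ, ℝ) c 0 0 m n = 0 := fun m n => by
    simp [nodePairing, hc.g_zero, hc.ξ_zero, modelDeriv_const]
  have h₁ : ∀ m n, nodePairing 𝓘(ℝ, ℝ) c 0 (Fin.last N) m n = 0 := fun m n => by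
    simp [nodePairing, hc.g_last, hc.ξ_last, modelDeriv_const]
  rw [h₀, h₁] at h
  have h' : HasFDerivAt (fun ε => P.action (c ε)) ((0 : ℝ →L[ℝ] ℝ) - 0) 0 :=
    hasMFDerivAt_iff_hasFDerivAt.1 h
  simpa using h'.hasDerivAt

omit [LieGroup 𝓘(ℝ, E) ∞ G] [FiniteDimensional ℝ E] in
theorem nodePairing_trajectory (hF : P.IsDiscreteFlow D F w) {N : ℕ} {z : CotTG E G}
    (hz : ∀ k < N, F^[k] z ∈ D) (j : Fin (N + 1)) :
    nodePairing (modelCot E) (P.trajectory F w N) z j (F^[(j : ℕ)] z).2.2.1 (F^[(j : ℕ)] z).2.2.2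
      = pullbackOneForm F^[(j : ℕ)] canonicalOneForm z :=
  (canonicalOneFormModel_comp ((hF.contMDiffAt_iterate fun i hi =>
    hz i (hi.trans_le j.is_le)).mdifferentiableAt (by simp))).symm

theorem hasMFDerivAt_action_trajectory (hF : P.IsDiscreteFlow D F w) {N : ℕ} {z : CotTG E G}
    (hz : ∀ k < N, F^[k] z ∈ D) :
    HasMFDerivAt (modelCot E) 𝓘(ℝ, ℝ) (fun y => P.action (P.trajectory F w N y)) z
      (pullbackOneForm F^[N] canonicalOneForm z - canonicalOneForm z) := by
  have h := hasMFDerivAt_action_family (P := P) (hF.isDifferentiableFamilyAt_trajectory hz)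
    (fun k => hF.isCriticalStep_trajectory k (hz k k.2)) (fun j => (F^[(j : ℕ)] z).2.2)
    (fun k => hF.initialMomenta_trajectory k (hz k k.2))
    (fun k => hF.finalMomenta_trajectory k (hz k k.2))
  -- The boundary term at the node `0` is the pullback of `θ` by the identity.
  have h0 : pullbackOneForm F^[0] canonicalOneForm z = canonicalOneForm z :=
    (congrArg (canonicalOneFormModel z).comp (modelDeriv_id z)).trans
      (ContinuousLinearMap.comp_id _)
  rw [hF.nodePairing_trajectory hz, hF.nodePairing_trajectory hz] at h
  refine h.congr_mfderiv ?_
  rw [← h0]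
  rfl

end IsDiscreteFlow

end Scheme

/-! ### Closedness of exact one-forms -/

section ExtDeriv

variable {W : Type*} [NormedAddCommGroup W] [NormedSpace ℝ W]

/-- A linear form as an alternating form of degree one. -/
abbrev oneForm (α : W →L[ℝ] ℝ) : W [⋀^Fin 1]→L[ℝ] ℝ :=
  ContinuousAlternatingMap.ofSubsingleton ℝ W ℝ (0 : Fin 1) α

theorem differentiableAt_oneForm {α : W → W →L[ℝ] ℝ} {x : W} (h : DifferentiableAt ℝ α x) :
    DifferentiableAt ℝ (fun y => oneForm (α y)) x :=
  ((ContinuousAlternatingMap.ofSubsingletonLIE (𝕜 := ℝ) (E := W) (F := ℝ)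
    (0 : Fin 1)).differentiable _).comp x h

/-- `d(df) = 0`. -/
theorem extDeriv_oneForm_eq_zero {f : W → ℝ} {f' : W → W →L[ℝ] ℝ} {x : W}
    (hf : ∀ᶠ y in 𝓝 x, HasFDerivAt f (f' y) y) (hf' : DifferentiableAt ℝ f' x) :
    extDeriv (fun y => oneForm (f' y)) x = 0 := by
  ext v
  rw [extDeriv_apply (differentiableAt_oneForm hf')]
  have hd : ∀ u, fderiv ℝ (fun y => f' y u) x = (fderiv ℝ f' x).flip u := fun u => by
    ext v
    rw [fderiv_clm_apply hf' (differentiableAt_const u)]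
    simp
  have hs := second_derivative_symmetric_of_eventually hf hf'.hasFDerivAt (v 0) (v 1)
  simp [Fin.sum_univ_two, hd, Fin.removeNth, hs]

end ExtDeriv

/-! ### From exactness of `Φ^*θ - θ` to preservation of `ω` -/

section Symplectic

variable {E : Type*} [NormedAddCommGroup E] [NormedSpace ℝ E]
  {G : Type*} [TopologicalSpace G] [ChartedSpace E G] [Group G] [LieGroup 𝓘(ℝ, E) ∞ G]

omit [Group G] [LieGroup 𝓘(ℝ, E) ∞ G] in
theorem contMDiffAt_extChartAt_cot_symm [IsManifold 𝓘(ℝ, E) ∞ G] {y : CotTG E G}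
    {x : ModelCotSpace E} (hx : x ∈ (extChartAt (modelCot E) y).target) :
    ContMDiffAt 𝓘(ℝ, ModelCotSpace E) (modelCot E) ∞ (extChartAt (modelCot E) y).symm x :=
  (contMDiffOn_extChartAt_symm y).contMDiffAt
    ((isOpen_extChartAt_target (I := modelCot E) y).mem_nhds hx)

/-- The canonical one-form in the chart at `y`. -/
def chartCanonicalOneForm (y : CotTG E G) (x : ModelCotSpace E) : ModelCotSpace E →L[ℝ] ℝ :=
  (canonicalOneFormModel ((extChartAt (modelCot E) y).symm x)).comp
    (modelDeriv 𝓘(ℝ, ModelCotSpace E) (modelCot E) (extChartAt (modelCot E) y).symm x)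

/-- The only term that is not evidently smooth is left trivialisation composed with the derivative
of the group component. It is the derivative at `t = x` of `g(x)⁻¹ g(t)`, a map equal to `1` on the
diagonal. -/
theorem differentiableAt_chartCanonicalOneForm (y : CotTG E G) :
    DifferentiableAt ℝ (chartCanonicalOneForm y) (extChartAt (modelCot E) y y) := by
  set φ := extChartAt (modelCot E) y with hφ
  set x₀ := φ y with hx₀
  have hmem : φ.target ∈ 𝓝 x₀ := extChartAt_target_mem_nhds y
  have hφs : ContMDiffAt 𝓘(ℝ, ModelCotSpace E) (modelCot E) ∞ φ.symm x₀ :=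
    contMDiffAt_extChartAt_cot_symm (mem_extChartAt_target y)
  have hg : ContMDiffAt 𝓘(ℝ, ModelCotSpace E) 𝓘(ℝ, E) ∞ (fun x => (φ.symm x).1) x₀ :=
    contMDiff_cot_g.contMDiffAt.comp x₀ hφs
  have hξ : ContDiffAt ℝ ∞ (fun x => (φ.symm x).2.1) x₀ :=
    (contMDiff_cot_ξ.contMDiffAt.comp x₀ hφs).contDiffAt
  have hμ : ContDiffAt ℝ ∞ (fun x => (φ.symm x).2.2.1) x₀ :=
    (contMDiff_cot_μ.contMDiffAt.comp x₀ hφs).contDiffAt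
  have hν : ContDiffAt ℝ ∞ (fun x => (φ.symm x).2.2.2) x₀ :=
    (contMDiff_cot_ν.contMDiffAt.comp x₀ hφs).contDiffAt
  have hL : ContDiffAt ℝ ∞ (fun x => modelDeriv 𝓘(ℝ, ModelCotSpace E) 𝓘(ℝ, E)
      (fun t => (φ.symm x).1⁻¹ * (φ.symm t).1) x) x₀ :=
    contDiffAt_modelDeriv_diag (f := fun x t => (φ.symm x).1⁻¹ * (φ.symm t).1) (g₀ := 1)
      ((hg.comp (x₀, x₀) contMDiffAt_fst).inv.mul (hg.comp (x₀, x₀) contMDiffAt_snd))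
      (Eventually.of_forall fun x => inv_mul_cancel _)
  have key : ContDiffAt ℝ ∞ (fun x => ((φ.symm x).2.2.1).comp
      (modelDeriv 𝓘(ℝ, ModelCotSpace E) 𝓘(ℝ, E) (fun t => (φ.symm x).1⁻¹ * (φ.symm t).1) x)
        + ((φ.symm x).2.2.2).comp (fderiv ℝ (fun t => (φ.symm t).2.1) x)) x₀ :=
    (hμ.clm_comp hL).add (hν.clm_comp (hξ.fderiv_right (m := ∞) (by simp)))
  refine (key.congr_of_eventuallyEq ?_).differentiableAt (by simp)
  filter_upwards [hmem] with x hx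
  have hs : MDifferentiableAt 𝓘(ℝ, ModelCotSpace E) (modelCot E) φ.symm x :=
    (contMDiffAt_extChartAt_cot_symm hx).mdifferentiableAt (by simp)
  have hgx : MDifferentiableAt 𝓘(ℝ, ModelCotSpace E) 𝓘(ℝ, E) (fun t => (φ.symm t).1) x :=
    (contMDiff_cot_g.mdifferentiable (by simp) _).comp x hs
  refine (canonicalOneFormModel_comp hs).trans ?_
  rw [ContinuousLinearMap.comp_assoc, leftTrivModel_eq, modelDeriv_eq_fderiv,
    ← modelDeriv_comp (f := fun t => (φ.symm t).1) (g := fun t => (φ.symm x).1⁻¹ * t) rfl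
      (mdifferentiableAt_mul mdifferentiableAt_const mdifferentiableAt_id) hgx]

/-- A map `Φ` preserves the canonical symplectic form at `z` if `Φ^*θ - θ` is exact near `z`. -/
theorem pullbackTwoForm_canonicalSymplecticForm {Φ : CotTG E G → CotTG E G} {S : CotTG E G → ℝ}
    {z : CotTG E G} (hΦ : ∀ᶠ y in 𝓝 z, ContMDiffAt (modelCot E) (modelCot E) ∞ Φ y)
    (hS : ∀ᶠ y in 𝓝 z, HasMFDerivAt (modelCot E) 𝓘(ℝ, ℝ) S y
      (pullbackOneForm Φ canonicalOneForm y - canonicalOneForm y)) :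
    pullbackTwoForm Φ canonicalSymplecticForm z = canonicalSymplecticForm z := by
  set φ := extChartAt (modelCot E) z with hφ
  set ψ := extChartAt (modelCot E) (Φ z) with hψ
  set x₀ := φ z with hx₀
  have hzx : φ.symm x₀ = z := extChartAt_to_inv z
  have hφs : ContMDiffAt 𝓘(ℝ, ModelCotSpace E) (modelCot E) ∞ φ.symm x₀ :=
    contMDiffAt_extChartAt_cot_symm (mem_extChartAt_target z)
  have htend : Tendsto φ.symm (𝓝 x₀) (𝓝 z) := by
    have := hφs.continuousAt.tendsto
    rwa [hzx] at this
  have hΦz : ContMDiffAt (modelCot E) (modelCot E) ∞ Φ z := hΦ.self_of_nhds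
  have hψz : ContMDiffAt (modelCot E) 𝓘(ℝ, ModelCotSpace E) ∞ ψ (Φ z) := contMDiffAt_extChartAt
  -- The exterior derivative at a point is computed in the chart at that point, so `Φ` is read
  -- between the chart at `z` and the chart at `Φ z`.
  set Φc : ModelCotSpace E → ModelCotSpace E := fun x => ψ (Φ (φ.symm x)) with hΦc
  have hΦcx : Φc x₀ = ψ (Φ z) := by rw [hΦc]; simp only [hzx]
  have hΦcs : ContDiffAt ℝ ∞ Φc x₀ := by
    refine ContMDiffAt.contDiffAt ?_
    refine ContMDiffAt.comp (I' := modelCot E) (g := ψ) x₀ (by rw [hzx]; exact hψz) ?_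
    exact ContMDiffAt.comp (I' := modelCot E) (g := Φ) x₀ (by rw [hzx]; exact hΦz) hφs
  set β := chartCanonicalOneForm (Φ z) with hβ
  set α := chartCanonicalOneForm z with hα
  have hβd : DifferentiableAt ℝ β (Φc x₀) := by
    rw [hΦcx]
    exact differentiableAt_chartCanonicalOneForm (Φ z)
  have hαd : DifferentiableAt ℝ α x₀ := differentiableAt_chartCanonicalOneForm z
  have hDΦ : DifferentiableAt ℝ (fderiv ℝ Φc) x₀ :=
    (hΦcs.fderiv_right (m := ∞) (by simp)).differentiableAt (by simp)
  -- In coordinates this is `Φ^*θ - θ`; it is shown below to be the derivative of `S` near `x₀`.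
  set f' : ModelCotSpace E → ModelCotSpace E →L[ℝ] ℝ :=
    fun x => (β (Φc x)).comp (fderiv ℝ Φc x) - α x with hf'
  have hβc : DifferentiableAt ℝ (fun x => β (Φc x)) x₀ :=
    DifferentiableAt.comp (g := β) (f := Φc) (G := ModelCotSpace E →L[ℝ] ℝ) x₀ hβd
      (hΦcs.differentiableAt (by simp))
  have hf'd : DifferentiableAt ℝ f' x₀ := DifferentiableAt.fun_sub (hβc.clm_comp hDΦ) hαd
  have hf : ∀ᶠ x in 𝓝 x₀, HasFDerivAt (fun x => S (φ.symm x)) (f' x) x := by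
    have hsrc : ∀ᶠ y in 𝓝 z, Φ y ∈ ψ.source :=
      hΦz.continuousAt.preimage_mem_nhds (extChartAt_source_mem_nhds (Φ z))
    filter_upwards [htend.eventually hΦ, htend.eventually hS, htend.eventually hsrc,
      extChartAt_target_mem_nhds (I := modelCot E) z] with x hΦx hSx hsx hx
    have hs : MDifferentiableAt 𝓘(ℝ, ModelCotSpace E) (modelCot E) φ.symm x :=
      (contMDiffAt_extChartAt_cot_symm hx).mdifferentiableAt (by simp)
    have hΦd : MDifferentiableAt (modelCot E) (modelCot E) Φ (φ.symm x) :=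
      hΦx.mdifferentiableAt (by simp)
    have hψd : MDifferentiableAt (modelCot E) 𝓘(ℝ, ModelCotSpace E) ψ (Φ (φ.symm x)) :=
      mdifferentiableAt_extChartAt (by rwa [hψ, extChartAt_source] at hsx)
    have hψs : MDifferentiableAt 𝓘(ℝ, ModelCotSpace E) (modelCot E) ψ.symm (Φc x) :=
      (contMDiffAt_extChartAt_cot_symm (ψ.map_source hsx)).mdifferentiableAt (by simp)
    have hinv : ψ.symm (Φc x) = Φ (φ.symm x) := ψ.left_inv hsx
    have hd : MDifferentiableAt 𝓘(ℝ, ModelCotSpace E) 𝓘(ℝ, ModelCotSpace E) Φc x :=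
      MDifferentiableAt.comp (I' := modelCot E) (g := ψ) x hψd
        (MDifferentiableAt.comp (I' := modelCot E) (g := Φ) x hΦd hs)
    have hchain : (modelDeriv 𝓘(ℝ, ModelCotSpace E) (modelCot E) ψ.symm (Φc x)).comp
          (fderiv ℝ Φc x)
        = (modelDeriv (modelCot E) (modelCot E) Φ (φ.symm x)).comp
          (modelDeriv 𝓘(ℝ, ModelCotSpace E) (modelCot E) φ.symm x) := by
      rw [← modelDeriv_eq_fderiv, ← modelDeriv_comp rfl hψs hd, ← modelDeriv_comp rfl hΦd hs]
      apply modelDeriv_congr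
      filter_upwards [((hΦd.continuousAt).comp hs.continuousAt).preimage_mem_nhds
        ((isOpen_extChartAt_source (I := modelCot E) (Φ z)).mem_nhds hsx)] with t ht
      exact ψ.left_inv ht
    have hcomp : HasMFDerivAt 𝓘(ℝ, ModelCotSpace E) 𝓘(ℝ, ℝ) (fun x => S (φ.symm x)) x
        ((((canonicalOneFormModel (Φ (φ.symm x))).comp
            (modelDeriv (modelCot E) (modelCot E) Φ (φ.symm x)))
          - canonicalOneFormModel (φ.symm x)).comp
          (modelDeriv 𝓘(ℝ, ModelCotSpace E) (modelCot E) φ.symm x) : ModelCotSpace E →L[ℝ] ℝ) :=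
      HasMFDerivAt.comp (I' := modelCot E) (f := φ.symm) (g := S) x hSx
        (hasMFDerivAt_modelDeriv hs)
    have heq : f' x = (((canonicalOneFormModel (Φ (φ.symm x))).comp
            (modelDeriv (modelCot E) (modelCot E) Φ (φ.symm x)))
          - canonicalOneFormModel (φ.symm x)).comp
          (modelDeriv 𝓘(ℝ, ModelCotSpace E) (modelCot E) φ.symm x) := by
      simp only [hf', hβ, hα, chartCanonicalOneForm]
      rw [ContinuousLinearMap.sub_comp, ContinuousLinearMap.comp_assoc,
        ContinuousLinearMap.comp_assoc, ← hψ, ← hφ, hchain, hinv]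
    rw [heq]
    exact hasMFDerivAt_iff_hasFDerivAt.1 hcomp
  -- Naturality of `d` under `Φc`. Writing the pulled-back form as `α + dS` and using `d(dS) = 0`
  -- then leaves `dα = Φc^*(dβ)` at `x₀`.
  have hpull : extDeriv (fun x => (oneForm (β (Φc x))).compContinuousLinearMap (fderiv ℝ Φc x)) x₀
      = (extDeriv (fun x => oneForm (β x)) (Φc x₀)).compContinuousLinearMap (fderiv ℝ Φc x₀) :=
    extDeriv_pullback (r := ∞) (differentiableAt_oneForm hβd) hΦcs
      (by rw [minSmoothness_of_isRCLikeNormedField]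
          exact WithTop.coe_le_coe.2 (le_top : (2 : ℕ∞) ≤ ⊤))
  have hsum : (fun x => (oneForm (β (Φc x))).compContinuousLinearMap (fderiv ℝ Φc x))
      = (fun x => oneForm (α x)) + fun x => oneForm (f' x) := by
    ext x v
    simp [hf']
  rw [hsum, extDeriv_add (differentiableAt_oneForm hαd) (differentiableAt_oneForm hf'd),
    extDeriv_oneForm_eq_zero hf hf'd, add_zero, hΦcx] at hpull
  -- Compatibility of `Φ` with `Φc`, used to carry the coordinate identity back to the tangent space
  -- at `z`.
  have hderiv : (modelDeriv (modelCot E) 𝓘(ℝ, ModelCotSpace E) ψ (Φ z)).comp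
        (modelDeriv (modelCot E) (modelCot E) Φ z)
      = (fderiv ℝ Φc x₀).comp (modelDeriv (modelCot E) 𝓘(ℝ, ModelCotSpace E) φ z) := by
    have hφz : ContMDiffAt (modelCot E) 𝓘(ℝ, ModelCotSpace E) ∞ φ z := contMDiffAt_extChartAt
    rw [← modelDeriv_eq_fderiv, ← modelDeriv_comp rfl (hψz.mdifferentiableAt (by simp))
        (hΦz.mdifferentiableAt (by simp)),
      ← modelDeriv_comp (f := φ) (g := Φc) (y := x₀) rfl
        (hΦcs.contMDiffAt.mdifferentiableAt (by simp))
        (hφz.mdifferentiableAt (by simp))]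
    apply modelDeriv_congr
    filter_upwards [extChartAt_source_mem_nhds (I := modelCot E) z] with y hy
    rw [hΦc]
    simp only [hφ, (extChartAt (modelCot E) z).left_inv hy]
  ext v
  have h₁ : pullbackTwoForm Φ canonicalSymplecticForm z v
      = -extDeriv (fun x => oneForm (β x)) (ψ (Φ z)) fun i =>
          (modelDeriv (modelCot E) 𝓘(ℝ, ModelCotSpace E) ψ (Φ z)).comp
            (modelDeriv (modelCot E) (modelCot E) Φ z) (v i) := rfl
  have h₂ : canonicalSymplecticForm z v
      = -extDeriv (fun x => oneForm (α x)) x₀ fun i =>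
          modelDeriv (modelCot E) 𝓘(ℝ, ModelCotSpace E) φ z (v i) := rfl
  rw [h₁, h₂, hpull, hderiv]
  rfl

end Symplectic

end HOHP

end

/-! ### The main theorem -/

theorem mainTheorem2 {E : Type*} [NormedAddCommGroup E] [NormedSpace ℝ E] [FiniteDimensional ℝ E]
    {G : Type*} [TopologicalSpace G] [ChartedSpace E G] [Group G] [LieGroup 𝓘(ℝ, E) ∞ G]
    {s : ℕ} (P : HOHP.Scheme E G s) (D : Set (HOHP.CotTG E G))
    (F : HOHP.CotTG E G → HOHP.CotTG E G) (w : HOHP.CotTG E G → HOHP.Stages E G s)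
    (hF : P.IsDiscreteFlow D F w) :
    (∀ (N : ℕ) [NeZero N] (z : HOHP.CotTG E G), (∀ k < N, F^[k] z ∈ D) →
      P.IsSolution (P.trajectory F w N z) ∧
      P.initial (P.trajectory F w N z) = z ∧
      (∀ k : Fin N, P.node (P.trajectory F w N z) k = F^[(k : ℕ) + 1] z) ∧
      HasMFDerivAt (HOHP.modelCot E) 𝓘(ℝ, ℝ) (fun y => P.action (P.trajectory F w N y)) z
        (HOHP.pullbackOneForm F^[N] HOHP.canonicalOneForm z - HOHP.canonicalOneForm z) ∧
      HOHP.pullbackTwoForm F^[N] HOHP.canonicalSymplecticForm z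
        = HOHP.canonicalSymplecticForm z) ∧
    (∀ z ∈ D, HOHP.pullbackTwoForm F HOHP.canonicalSymplecticForm z
        = HOHP.canonicalSymplecticForm z) := by
  have hsymp : ∀ (N : ℕ) (z : HOHP.CotTG E G), (∀ k < N, F^[k] z ∈ D) →
      HOHP.pullbackTwoForm F^[N] HOHP.canonicalSymplecticForm z
        = HOHP.canonicalSymplecticForm z := by
    intro N z hz
    -- Taking `d` requires the formula for `ds` on a neighbourhood of `z`. The conditions on the
    -- iterates are finitely many and open, so they persist near `z`.
    have hev : ∀ᶠ y in nhds z, ∀ k ∈ Set.Iio N, F^[k] y ∈ D :=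
      (Filter.eventually_all_finite (Set.finite_Iio N)).2 fun k hk =>
        (hF.contMDiffAt_iterate fun j hj => hz j (hj.trans hk)).continuousAt.preimage_mem_nhds
          (hF.isOpen.mem_nhds (hz k hk))
    exact HOHP.pullbackTwoForm_canonicalSymplecticForm
      (hev.mono fun y hy => hF.contMDiffAt_iterate hy)
      (hev.mono fun y hy => hF.hasMFDerivAt_action_trajectory hy)
  refine ⟨fun N _ z hz => ⟨hF.isSolution_trajectory hz,
    hF.initial_trajectory (hz 0 (NeZero.pos N)), fun k => hF.node_trajectory k (hz k k.2),
    hF.hasMFDerivAt_action_trajectory hz, hsymp N z hz⟩, fun z hz => ?_⟩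
  exact hsymp 1 z fun k hk => by
    obtain rfl := Nat.lt_one_iff.1 hk
    exact hz
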